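/- Let $(\mathcal A;\mathcal E)$ be a Frobenius category, that is, an exact category (in the sense of Quillen) with enough projective and enough injective objects in which the projective objects coincide with the injective ones. Let $\omega$ be the full subcategory of projective objects and $\mathcal A/\omega$ the stable category: it has the same objects, morphisms are taken modulo those that factor through an object of $\omega$, the shift $[1]$ is given by choosing conflations $A\to I\to A[1]$ with $I\in\omega$, and the distinguished triangles are the usual ones. Let $\mathcal D$ be $\mathcal A$ or $\mathcal A/\omega$. An ideal of $\mathcal D$ is a class of morphisms that consists of a subgroup of each $\operatorname{Hom}(A,B)$ and is closed under composition on either side with arbitrary morphisms. For an ideal $\mathcal I$, an $\mathcal I$-precover of $X$ is a morphism $A\to X$ in $\mathcal I$ through which every morphism of $\mathcal I$ with target $X$ factors; $\mathcal I$ is precovering if every object has an $\mathcal I$-precover. Preenvelopes and preenveloping ideals are defined dually. Orthogonality. In $\mathcal A$, morphisms $a:A_0\to A_1$ and $b:B_0\to B_1$ are orthogonal, $a\perp b$, if $\operatorname{Ext}(a,b):\operatorname{Ext}(A_1,B_0)\to\operatorname{Ext}(A_0,B_1)$ is zero, where $\operatorname{Ext}(A,B)$ denotes the group of equivalence classes of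 conflations $B\to E\to A$. In $\mathcal A/\omega$, morphisms $a:X\to A$ and $b:B\to Y$ are orthogonal, $a\perp b$, if $b[1]\,\varphi\, a=0$ for every $\varphi:A\to B[1]$. For a class $\mathcal M$ of morphisms put ${}^\perp\mathcal M=\{a: a\perp m\text{ for all }m\in\mathcal M\}$ and $\mathcal M^\perp=\{b: m\perp b\text{ for all }m\in\mathcal M\}$. An ideal cotorsion pair is a pair of ideals $(\mathcal I,\mathcal J)$ with $\mathcal I={}^\perp\mathcal J$ and $\mathcal J=\mathcal I^\perp$. Special approximations. In $\mathcal A$, an $\mathcal I$-precover $f:A\to X$ is special if it is a deflation and the conflation $L\to A\xrightarrow{f}X$ is the pushout of a conflation $K\to A'\to X$ along some $g:K\to L$ with $g\in\mathcal I^\perp$. In $\mathcal A/\omega$, an $\mathcal I$-precover $i:X\to A$ is special if there is a morphism of distinguished triangles $$(j,\,t,\,1_A,\,j[1]):\ (Y\to Z\to A\to Y[1])\longrightarrow(B\to X\xrightarrow{\,i\,}A\to B[1])$$ whose left square is homotopy cartesian, with $j\in\mathcal I^\perp$. Special preenvelopes are defined dually. An ideal cotorsion pair $(\mathcal I,\mathcal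 J)$ is complete if every object has a special $\mathcal I$-precover and a special $\mathcal J$-preenvelope. For an ideal $\mathcal I$ of $\mathcal A$, let $\mathcal I/\omega$ be the class of the images in $\mathcal A/\omega$ of the morphisms in $\mathcal I$. **Corollary.** Let $(\mathcal I,\mathcal J)$ be an ideal cotorsion pair in a Frobenius category $(\mathcal A;\mathcal E)$. Then the following statements are equivalent. 1. $\mathcal I$ is precovering in $\mathcal A$. 2. $\mathcal J$ is preenveloping in $\mathcal A$. 3. $(\mathcal I,\mathcal J)$ is a complete ideal cotorsion pair in $\mathcal A$. 4. $(\mathcal I/\omega,\mathcal J/\omega)$ is a complete ideal cotorsion pair in $\mathcal A/\omega$. -/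

import Mathlib

open CategoryTheory CategoryTheory.Limits

universe v u

section Approximation

variable {D : Type u} [Category.{v} D]

/-- `f : A ⟶ X` is an `I`-precover of `X`: it lies in `I` and every morphism of `I` with target `X`
factors through it. -/
def IsPrecover (I : MorphismProperty D) {A X : D} (f : A ⟶ X) : Prop :=
  I f ∧ ∀ ⦃A' : D⦄ (f' : A' ⟶ X), I f' → ∃ h : A' ⟶ A, h ≫ f = f'

/-- `f : X ⟶ A` is an `I`-preenvelope of `X`. -/
def IsPreenvelope (I : MorphismProperty D) {X A : D} (f : X ⟶ A) : Prop :=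
  I f ∧ ∀ ⦃A' : D⦄ (f' : X ⟶ A'), I f' → ∃ h : A ⟶ A', f ≫ h = f'

/-- The class `I` of morphisms is precovering. -/
def IsPrecovering (I : MorphismProperty D) : Prop :=
  ∀ X : D, ∃ (A : D) (f : A ⟶ X), IsPrecover I f

/-- The class `I` of morphisms is preenveloping. -/
def IsPreenveloping (I : MorphismProperty D) : Prop :=
  ∀ X : D, ∃ (A : D) (f : X ⟶ A), IsPreenvelope I f

/-- A class of morphisms of a preadditive category is an ideal: it consists of subgroups of the
morphism groups and is stable under composition on both sides with arbitrary morphisms. -/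
structure IsMorphismIdeal [Preadditive D] (I : MorphismProperty D) : Prop where
  zero_mem : ∀ X Y : D, I (0 : X ⟶ Y)
  add_mem : ∀ {X Y : D} (f g : X ⟶ Y), I f → I g → I (f + g)
  neg_mem : ∀ {X Y : D} (f : X ⟶ Y), I f → I (-f)
  comp_mem : ∀ {X A B Y : D} (h : X ⟶ A) (g : A ⟶ B) (f : B ⟶ Y), I g → I (h ≫ g ≫ f)

end Approximation

/-- An exact structure (in the sense of Quillen) on an additive category: a class of kernel-cokernel
pairs `X ⟶ Y ⟶ Z`, closed under isomorphisms, such that (inflations being the first morphisms and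
deflations the second morphisms of such pairs) identities are inflations and deflations, inflations
and deflations are closed under composition, the pushout of an inflation along an arbitrary morphism
exists and is an inflation, and the pullback of a deflation along an arbitrary morphism exists and
is a deflation. -/
structure ExactStructure (C : Type u) [Category.{v} C] [Preadditive C] where
  /-- `Conf i p` says that `X ⟶ Y ⟶ Z` is a conflation. -/
  Conf : ∀ {X Y Z : C}, (X ⟶ Y) → (Y ⟶ Z) → Prop
  zero : ∀ {X Y Z : C} {i : X ⟶ Y} {p : Y ⟶ Z}, Conf i p → i ≫ p = 0
  isKernel : ∀ {X Y Z : C} {i : X ⟶ Y} {p : Y ⟶ Z} (h : Conf i p),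
    Nonempty (IsLimit (KernelFork.ofι i (zero h)))
  isCokernel : ∀ {X Y Z : C} {i : X ⟶ Y} {p : Y ⟶ Z} (h : Conf i p),
    Nonempty (IsColimit (CokernelCofork.ofπ p (zero h)))
  of_iso : ∀ {X Y Z X' Y' Z' : C} {i : X ⟶ Y} {p : Y ⟶ Z} {i' : X' ⟶ Y'} {p' : Y' ⟶ Z'}
    (a : X ≅ X') (b : Y ≅ Y') (c : Z ≅ Z'),
    i ≫ b.hom = a.hom ≫ i' → p ≫ c.hom = b.hom ≫ p' → Conf i p → Conf i' p'
  id_inflation : ∀ X : C, ∃ (Z : C) (p : X ⟶ Z), Conf (𝟙 X) p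
  id_deflation : ∀ X : C, ∃ (K : C) (i : K ⟶ X), Conf i (𝟙 X)
  comp_inflation : ∀ {X Y Z : C} (i : X ⟶ Y) (j : Y ⟶ Z),
    (∃ (W : C) (p : Y ⟶ W), Conf i p) → (∃ (W : C) (p : Z ⟶ W), Conf j p) →
      ∃ (W : C) (p : Z ⟶ W), Conf (i ≫ j) p
  comp_deflation : ∀ {X Y Z : C} (p : X ⟶ Y) (q : Y ⟶ Z),
    (∃ (K : C) (i : K ⟶ X), Conf i p) → (∃ (K : C) (i : K ⟶ Y), Conf i q) →
      ∃ (K : C) (i : K ⟶ X), Conf i (p ≫ q)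
  pushout_inflation : ∀ {X Y X' : C} (i : X ⟶ Y) (f : X ⟶ X'),
    (∃ (W : C) (p : Y ⟶ W), Conf i p) →
      ∃ (Y' : C) (g : Y ⟶ Y') (i' : X' ⟶ Y'), IsPushout i f g i' ∧
        ∃ (W : C) (p : Y' ⟶ W), Conf i' p
  pullback_deflation : ∀ {Y Z Z' : C} (p : Y ⟶ Z) (f : Z' ⟶ Z),
    (∃ (K : C) (i : K ⟶ Y), Conf i p) →
      ∃ (Y' : C) (g : Y' ⟶ Y) (p' : Y' ⟶ Z'), IsPullback g p' p f ∧
        ∃ (K : C) (i : K ⟶ Y'), Conf i p'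

namespace ExactStructure

variable {C : Type u} [Category.{v} C] [Preadditive C] (E : ExactStructure C)

/-- Inflations, that is, admissible monomorphisms. -/
def Inflation {X Y : C} (i : X ⟶ Y) : Prop := ∃ (Z : C) (p : Y ⟶ Z), E.Conf i p

/-- Deflations, that is, admissible epimorphisms. -/
def Deflation {Y Z : C} (p : Y ⟶ Z) : Prop := ∃ (X : C) (i : X ⟶ Y), E.Conf i p

/-- `P` is projective: every deflation ending at `P` splits. -/
def IsProj (P : C) : Prop :=
  ∀ ⦃X : C⦄ (p : X ⟶ P), E.Deflation p → ∃ s : P ⟶ X, s ≫ p = 𝟙 P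

/-- `I` is injective: every inflation starting at `I` splits. -/
def IsInj (I : C) : Prop :=
  ∀ ⦃X : C⦄ (i : I ⟶ X), E.Inflation i → ∃ r : X ⟶ I, i ≫ r = 𝟙 I

/-- The exact category `(C, E)` is Frobenius: it has enough projectives and enough injectives, and
the projective objects are the injective ones. -/
class IsFrobenius : Prop where
  enough_proj : ∀ X : C, ∃ (P : C) (p : P ⟶ X), E.IsProj P ∧ E.Deflation p
  enough_inj : ∀ X : C, ∃ (I : C) (i : X ⟶ I), E.IsInj I ∧ E.Inflation i
  proj_iff_inj : ∀ X : C, E.IsProj X ↔ E.IsInj X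

/-! ### Elementary facts -/

variable {E}

lemma Conf.ext_desc {X Y Z W : C} {i : X ⟶ Y} {p : Y ⟶ Z} (h : E.Conf i p) {f g : Z ⟶ W}
    (e : p ≫ f = p ≫ g) : f = g :=
  Cofork.IsColimit.hom_ext (E.isCokernel h).some e

lemma Conf.ext_lift {X Y Z W : C} {i : X ⟶ Y} {p : Y ⟶ Z} (h : E.Conf i p) {f g : W ⟶ X}
    (e : f ≫ i = g ≫ i) : f = g :=
  Fork.IsLimit.hom_ext (E.isKernel h).some e

lemma Conf.exists_desc {X Y Z W : C} {i : X ⟶ Y} {p : Y ⟶ Z} (h : E.Conf i p) (f : Y ⟶ W)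
    (e : i ≫ f = 0) : ∃ g : Z ⟶ W, p ≫ g = f :=
  ⟨(CokernelCofork.IsColimit.desc' (E.isCokernel h).some f e).1,
    (CokernelCofork.IsColimit.desc' (E.isCokernel h).some f e).2⟩

lemma Conf.exists_lift {X Y Z W : C} {i : X ⟶ Y} {p : Y ⟶ Z} (h : E.Conf i p) (f : W ⟶ Y)
    (e : f ≫ p = 0) : ∃ g : W ⟶ X, g ≫ i = f :=
  ⟨(KernelFork.IsLimit.lift' (E.isKernel h).some f e).1,
    (KernelFork.IsLimit.lift' (E.isKernel h).some f e).2⟩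

/-- An inflation together with any cokernel of it is a conflation. -/
lemma Inflation.conf {X Y Z : C} {i : X ⟶ Y} (hi : E.Inflation i) (p : Y ⟶ Z) (w : i ≫ p = 0)
    (hd : ∀ {W : C} (f : Y ⟶ W), i ≫ f = 0 → ∃ g : Z ⟶ W, p ≫ g = f)
    (hu : ∀ {W : C} (f g : Z ⟶ W), p ≫ f = p ≫ g → f = g) : E.Conf i p := by
  obtain ⟨Z₀, q, hq⟩ := hi
  obtain ⟨a, ha⟩ := hq.exists_desc p w
  obtain ⟨b, hb⟩ := hd q (E.zero hq)
  refine E.of_iso (Iso.refl X) (Iso.refl Y) ⟨a, b, ?_, ?_⟩ (by simp) (by simpa using ha) hq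
  · apply hq.ext_desc
    rw [← Category.assoc, ha, hb, Category.comp_id]
  · apply hu
    rw [← Category.assoc, hb, ha, Category.comp_id]

/-- A deflation together with any kernel of it is a conflation. -/
lemma Deflation.conf {X Y Z : C} {p : Y ⟶ Z} (hp : E.Deflation p) (i : X ⟶ Y) (w : i ≫ p = 0)
    (hl : ∀ {W : C} (f : W ⟶ Y), f ≫ p = 0 → ∃ g : W ⟶ X, g ≫ i = f)
    (hu : ∀ {W : C} (f g : W ⟶ X), f ≫ i = g ≫ i → f = g) : E.Conf i p := by
  obtain ⟨X₀, j, hj⟩ := hp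
  obtain ⟨a, ha⟩ := hj.exists_lift i w
  obtain ⟨b, hb⟩ := hl j (E.zero hj)
  refine E.of_iso ⟨b, a, ?_, ?_⟩ (Iso.refl Y) (Iso.refl Z) (by simpa using hb.symm) (by simp) hj
  · apply hj.ext_lift
    rw [Category.assoc, ha, hb, Category.id_comp]
  · apply hu
    rw [Category.assoc, hb, ha, Category.id_comp]

lemma Conf.exists_pushout {A B B' M : C} {i : B ⟶ M} {p : M ⟶ A} (h : E.Conf i p) (b : B ⟶ B') :
    ∃ (M' : C) (j : M ⟶ M') (i' : B' ⟶ M') (p' : M' ⟶ A),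
      IsPushout i b j i' ∧ j ≫ p' = p ∧ E.Conf i' p' := by
  obtain ⟨M', j, i', hpo, hi'⟩ := E.pushout_inflation i b ⟨_, p, h⟩
  refine ⟨M', j, i', hpo.desc p 0 (by rw [E.zero h, comp_zero]), hpo, by simp, ?_⟩
  refine Inflation.conf hi' _ (by simp) ?_ ?_
  · intro W f hf
    obtain ⟨g, hg⟩ := h.exists_desc (j ≫ f)
      (by rw [← Category.assoc, hpo.w, Category.assoc, hf, comp_zero])
    refine ⟨g, hpo.hom_ext ?_ ?_⟩
    · rw [← Category.assoc, hpo.inl_desc, hg]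
    · rw [← Category.assoc, hpo.inr_desc, zero_comp, hf]
  · intro W f g hfg
    apply h.ext_desc
    have := congrArg (fun k => j ≫ k) hfg
    simpa using this

lemma Conf.exists_pullback {A A' B M : C} {i : B ⟶ M} {p : M ⟶ A} (h : E.Conf i p) (a : A' ⟶ A) :
    ∃ (M' : C) (j : M' ⟶ M) (p' : M' ⟶ A') (i' : B ⟶ M'),
      IsPullback j p' p a ∧ i' ≫ j = i ∧ E.Conf i' p' := by
  obtain ⟨M', j, p', hpb, hp'⟩ := E.pullback_deflation p a ⟨_, i, h⟩
  refine ⟨M', j, p', hpb.lift i 0 (by rw [E.zero h, zero_comp]), hpb, by simp, ?_⟩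
  refine Deflation.conf hp' _ (by simp) ?_ ?_
  · intro W f hf
    obtain ⟨g, hg⟩ := h.exists_lift (f ≫ j)
      (by rw [Category.assoc, hpb.w, ← Category.assoc, hf, zero_comp])
    refine ⟨g, hpb.hom_ext ?_ ?_⟩
    · rw [Category.assoc, hpb.lift_fst, hg]
    · rw [Category.assoc, hpb.lift_snd, comp_zero, hf]
  · intro W f g hfg
    apply h.ext_lift
    have := congrArg (fun k => k ≫ j) hfg
    simpa using this

/-- The split sequence `B ⟶ B ⊞ A ⟶ A` is a conflation. -/
lemma conf_split [HasBinaryBiproducts C] (A B : C) :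
    E.Conf (biprod.inl : B ⟶ B ⊞ A) (biprod.snd : B ⊞ A ⟶ A) := by
  obtain ⟨Z, i, hi⟩ := E.id_deflation A
  have hi0 : i = 0 := by simpa using E.zero hi
  subst hi0
  obtain ⟨M, j, i', p', hpo, hj, hc⟩ := hi.exists_pushout (0 : Z ⟶ B)
  have h1 : i' ≫ p' = 0 := E.zero hc
  let φ : M ⟶ B ⊞ A := hpo.desc biprod.inr biprod.inl (by simp)
  have h2 : j ≫ φ = biprod.inr := hpo.inl_desc _ _ _
  have h3 : i' ≫ φ = biprod.inl := hpo.inr_desc _ _ _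
  refine E.of_iso (Iso.refl B) ⟨φ, biprod.desc i' j, ?_, ?_⟩ (Iso.refl A) (by simp [h3]) ?_ hc
  · apply hpo.hom_ext
    · rw [← Category.assoc, h2]; simp
    · rw [← Category.assoc, h3]; simp
  · apply biprod.hom_ext'
    · simp [h3]
    · simp [h2]
  · apply hpo.hom_ext
    · simp [← Category.assoc, h2, hj]
    · simp [← Category.assoc, h3, h1]

lemma IsInj.exists_extend {I : C} (hI : E.IsInj I) {X Y : C} {i : X ⟶ Y} (hi : E.Inflation i)
    (f : X ⟶ I) : ∃ g : Y ⟶ I, i ≫ g = f := by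
  obtain ⟨Y', g, i', hpo, hi'⟩ := E.pushout_inflation i f hi
  obtain ⟨r, hr⟩ := hI i' hi'
  exact ⟨g ≫ r, by rw [← Category.assoc, hpo.w, Category.assoc, hr, Category.comp_id]⟩

lemma IsProj.exists_lift {P : C} (hP : E.IsProj P) {Y Z : C} {p : Y ⟶ Z} (hp : E.Deflation p)
    (f : P ⟶ Z) : ∃ g : P ⟶ Y, g ≫ p = f := by
  obtain ⟨Y', g, p', hpb, hp'⟩ := E.pullback_deflation p f hp
  obtain ⟨s, hs⟩ := hP p' hp'
  exact ⟨s ≫ g, by rw [Category.assoc, hpb.w, ← Category.assoc, hs, Category.id_comp]⟩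

lemma IsProj.biprod [HasBinaryBiproducts C] {P Q : C} (hP : E.IsProj P) (hQ : E.IsProj Q) :
    E.IsProj (P ⊞ Q) := by
  intro X p hp
  obtain ⟨s, hs⟩ := hP.exists_lift hp biprod.inl
  obtain ⟨t, ht⟩ := hQ.exists_lift hp biprod.inr
  exact ⟨biprod.desc s t, by apply biprod.hom_ext' <;> simp [hs, ht]⟩

variable (E)

lemma exists_isProj [HasZeroObject C] : ∃ P : C, E.IsProj P := by
  open ZeroObject in
  exact ⟨0, fun X p _ => ⟨0, (isZero_zero C).eq_of_src _ _⟩⟩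

/-! ### Extensions, the functor `Ext` and orthogonality in the exact category -/

/-- An extension of `A` by `B`: a conflation `B ⟶ mid ⟶ A`. -/
structure Extension (A B : C) where
  /-- the middle term -/
  mid : C
  /-- the inflation -/
  i : B ⟶ mid
  /-- the deflation -/
  p : mid ⟶ A
  conf : E.Conf i p

/-- Two extensions of `A` by `B` are equivalent if they are isomorphic through an isomorphism which
is the identity on `A` and on `B`. -/
instance extensionSetoid (A B : C) : Setoid (E.Extension A B) where
  r ξ ζ := ∃ e : ξ.mid ≅ ζ.mid, ξ.i ≫ e.hom = ζ.i ∧ e.hom ≫ ζ.p = ξ.p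
  iseqv :=
    { refl := fun ξ => ⟨Iso.refl _, by simp, by simp⟩
      symm := by
        rintro ξ ζ ⟨e, h1, h2⟩
        exact ⟨e.symm, by simp [← h1], by simp [← h2]⟩
      trans := by
        rintro ξ ζ χ ⟨e, h1, h2⟩ ⟨f, h3, h4⟩
        exact ⟨e ≪≫ f, by simp [← h3, ← h1], by simp [h4, h2]⟩ }

/-- `Ext A B = Ext¹(A, B)`: equivalence classes of extensions of `A` by `B`. -/
def Ext (A B : C) : Type (max u v) := Quotient (E.extensionSetoid A B)

/-- The zero element of `Ext A B` is the class of the split extension. -/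
noncomputable instance [HasBinaryBiproducts C] (A B : C) : Zero (E.Ext A B) where
  zero := Quotient.mk _ ⟨B ⊞ A, biprod.inl, biprod.snd, conf_split A B⟩

/-- The pushout of an extension of `A` by `B` along `b : B ⟶ B'`. -/
noncomputable def Extension.push {E : ExactStructure C} {A B B' : C} (ξ : E.Extension A B)
    (b : B ⟶ B') : E.Extension A B' :=
  ⟨_, _, _, (ξ.conf.exists_pushout b).choose_spec.choose_spec.choose_spec.choose_spec.2.2⟩

lemma Extension.push_spec {E : ExactStructure C} {A B B' : C} (ξ : E.Extension A B) (b : B ⟶ B') :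
    ∃ j : ξ.mid ⟶ (ξ.push b).mid, IsPushout ξ.i b j (ξ.push b).i ∧ j ≫ (ξ.push b).p = ξ.p :=
  ⟨_, (ξ.conf.exists_pushout b).choose_spec.choose_spec.choose_spec.choose_spec.1,
    (ξ.conf.exists_pushout b).choose_spec.choose_spec.choose_spec.choose_spec.2.1⟩

/-- The pullback of an extension of `A` by `B` along `a : A' ⟶ A`. -/
noncomputable def Extension.pull {E : ExactStructure C} {A A' B : C} (ξ : E.Extension A B)
    (a : A' ⟶ A) : E.Extension A' B :=
  ⟨_, _, _, (ξ.conf.exists_pullback a).choose_spec.choose_spec.choose_spec.choose_spec.2.2⟩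

lemma Extension.pull_spec {E : ExactStructure C} {A A' B : C} (ξ : E.Extension A B) (a : A' ⟶ A) :
    ∃ j : (ξ.pull a).mid ⟶ ξ.mid, IsPullback j (ξ.pull a).p ξ.p a ∧ (ξ.pull a).i ≫ j = ξ.i :=
  ⟨_, (ξ.conf.exists_pullback a).choose_spec.choose_spec.choose_spec.choose_spec.1,
    (ξ.conf.exists_pullback a).choose_spec.choose_spec.choose_spec.choose_spec.2.1⟩

/-- Pushouts of equivalent extensions are equivalent. -/
lemma Extension.push_congr {E : ExactStructure C} {A B B' : C} (ξ ζ : E.Extension A B)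
    (b : B ⟶ B') (h : ξ ≈ ζ) : ξ.push b ≈ ζ.push b := by
  obtain ⟨e, h1, h2⟩ := h
  obtain ⟨j, hj, hjp⟩ := ξ.push_spec b
  obtain ⟨k, hk, hkp⟩ := ζ.push_spec b
  have hk' : IsPushout ξ.i b (e.hom ≫ k) (ζ.push b).i :=
    hk.of_iso (Iso.refl _) e.symm (Iso.refl _) (Iso.refl _) (by simp [← h1]) (by simp) (by simp)
      (by simp)
  refine ⟨hj.isoIsPushout _ _ hk', by simp, ?_⟩
  apply hj.hom_ext
  · simp [hkp, h2, hjp]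
  · simp [E.zero (ζ.push b).conf, E.zero (ξ.push b).conf]

/-- Pullbacks of equivalent extensions are equivalent. -/
lemma Extension.pull_congr {E : ExactStructure C} {A A' B : C} (ξ ζ : E.Extension A B)
    (a : A' ⟶ A) (h : ξ ≈ ζ) : ξ.pull a ≈ ζ.pull a := by
  obtain ⟨e, h1, h2⟩ := h
  obtain ⟨j, hj, hji⟩ := ξ.pull_spec a
  obtain ⟨k, hk, hki⟩ := ζ.pull_spec a
  have hj' : IsPullback (j ≫ e.hom) (ξ.pull a).p ζ.p a :=
    hj.of_iso (Iso.refl _) e (Iso.refl _) (Iso.refl _) (by simp) (by simp) (by simp [h2])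
      (by simp)
  refine ⟨hj'.isoIsPullback _ _ hk, ?_, by simp⟩
  apply hk.hom_ext
  · simp only [Category.assoc, IsPullback.isoIsPullback_hom_fst, hki]
    rw [← Category.assoc, hji, h1]
  · simp [E.zero (ζ.pull a).conf, E.zero (ξ.pull a).conf]

/-- The map `Ext(a, b) : Ext(A₁, B₀) → Ext(A₀, B₁)` induced by `a : A₀ ⟶ A₁` and `b : B₀ ⟶ B₁`:
push out along `b`, then pull back along `a`. -/
noncomputable def extMap {A₀ A₁ B₀ B₁ : C} (a : A₀ ⟶ A₁) (b : B₀ ⟶ B₁) :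
    E.Ext A₁ B₀ → E.Ext A₀ B₁ :=
  Quotient.map (fun ξ => (ξ.push b).pull a)
    (fun _ _ h => Extension.pull_congr _ _ a (Extension.push_congr _ _ b h))

variable [HasZeroObject C] [HasBinaryBiproducts C]

/-- `a` and `b` are `Ext`-orthogonal: the map `Ext(a, b)` is zero. -/
def ExtOrthogonal {A₀ A₁ B₀ B₁ : C} (a : A₀ ⟶ A₁) (b : B₀ ⟶ B₁) : Prop :=
  ∀ ξ : E.Ext A₁ B₀, E.extMap a b ξ = 0

/-- `ᗮM`, the class of all `a` with `Ext(a, m) = 0` for all `m ∈ M`. -/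
def leftPerp (M : MorphismProperty C) : MorphismProperty C :=
  fun _ _ a => ∀ ⦃B₀ B₁ : C⦄ (m : B₀ ⟶ B₁), M m → E.ExtOrthogonal a m

/-- `Mᗮ`, the class of all `b` with `Ext(m, b) = 0` for all `m ∈ M`. -/
def rightPerp (M : MorphismProperty C) : MorphismProperty C :=
  fun _ _ b => ∀ ⦃A₀ A₁ : C⦄ (m : A₀ ⟶ A₁), M m → E.ExtOrthogonal m b

/-- `(I, J)` is an ideal cotorsion pair in the exact category. -/
structure IsIdealCotorsionPair (I J : MorphismProperty C) : Prop where
  left_ideal : IsMorphismIdeal I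
  right_ideal : IsMorphismIdeal J
  left_eq : I = E.leftPerp J
  right_eq : J = E.rightPerp I

/-- `f : A ⟶ X` is a special `I`-precover: it is an `I`-precover and a deflation which fits in a
pushout diagram of conflations
```
K ⟶ A' ⟶ X
↓g   ↓t    ‖
L ⟶ A  ⟶ X
        f
```
with `g ∈ Iᗮ`. -/
def IsSpecialPrecover (I : MorphismProperty C) {A X : C} (f : A ⟶ X) : Prop :=
  IsPrecover I f ∧
    ∃ (K A' L : C) (k : K ⟶ A') (p : A' ⟶ X) (l : L ⟶ A) (g : K ⟶ L) (t : A' ⟶ A),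
      E.Conf k p ∧ E.Conf l f ∧ IsPushout k g t l ∧ t ≫ f = p ∧ E.rightPerp I g

/-- `f : X ⟶ A` is a special `J`-preenvelope: it is a `J`-preenvelope and an inflation which fits in
a pullback diagram of conflations
```
   f
X ⟶ A  ⟶ L
‖    ↓t    ↓g
X ⟶ A' ⟶ K
```
with `g ∈ ᗮJ`. -/
def IsSpecialPreenvelope (J : MorphismProperty C) {X A : C} (f : X ⟶ A) : Prop :=
  IsPreenvelope J f ∧
    ∃ (L A' K : C) (l : A ⟶ L) (i : X ⟶ A') (k : A' ⟶ K) (g : L ⟶ K) (t : A ⟶ A'),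
      E.Conf f l ∧ E.Conf i k ∧ IsPullback t l k g ∧ f ≫ t = i ∧ E.leftPerp J g

/-- `(I, J)` is a complete ideal cotorsion pair in the exact category: it is an ideal cotorsion pair
and every object has a special `J`-preenvelope and a special `I`-precover. -/
structure IsCompleteIdealCotorsionPair (I J : MorphismProperty C) : Prop where
  isIdealCotorsionPair : E.IsIdealCotorsionPair I J
  exists_preenvelope : ∀ X : C, ∃ (A : C) (f : X ⟶ A), E.IsSpecialPreenvelope J f
  exists_precover : ∀ X : C, ∃ (A : C) (f : A ⟶ X), E.IsSpecialPrecover I f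

/-! ### The stable category -/

/-- Two parallel morphisms are identified in the stable category if their difference factors through
a projective object. -/
def stableRel : HomRel C := fun X Y f g =>
  ∃ (P : C) (s : X ⟶ P) (t : P ⟶ Y), E.IsProj P ∧ f - g = s ≫ t

lemma stableRel_add ⦃X Y : C⦄ (f₁ f₂ g₁ g₂ : X ⟶ Y) (hf : E.stableRel f₁ f₂)
    (hg : E.stableRel g₁ g₂) : E.stableRel (f₁ + g₁) (f₂ + g₂) := by
  obtain ⟨P, s, t, hP, h⟩ := hf
  obtain ⟨Q, s', t', hQ, h'⟩ := hg
  refine ⟨P ⊞ Q, biprod.lift s s', biprod.desc t t', hP.biprod hQ, ?_⟩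
  rw [biprod.lift_desc, ← h, ← h']
  abel

instance stableRel_congruence : Congruence E.stableRel where
  equivalence := fun {X Y} =>
    { refl := fun f => by
        obtain ⟨P, hP⟩ := E.exists_isProj
        exact ⟨P, 0, 0, hP, by simp⟩
      symm := by
        rintro f g ⟨P, s, t, hP, h⟩
        exact ⟨P, -s, t, hP, by rw [Preadditive.neg_comp, ← h, neg_sub]⟩
      trans := by
        rintro f g k ⟨P, s, t, hP, h⟩ ⟨Q, s', t', hQ, h'⟩
        refine ⟨P ⊞ Q, biprod.lift s s', biprod.desc t t', hP.biprod hQ, ?_⟩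
        rw [biprod.lift_desc, ← h, ← h']
        abel }
  comp_left := by
    rintro X Y Z f g g' ⟨P, s, t, hP, h⟩
    exact ⟨P, f ≫ s, t, hP, by rw [← Preadditive.comp_sub, h, Category.assoc]⟩
  comp_right := by
    rintro X Y Z f f' g ⟨P, s, t, hP, h⟩
    exact ⟨P, s, t ≫ g, hP, by rw [← Preadditive.sub_comp, h, Category.assoc]⟩

/-- The stable category `C/ω`, where `ω` is the class of projective objects. -/
abbrev Stable : Type u := CategoryTheory.Quotient E.stableRel

instance : Preadditive E.Stable :=
  CategoryTheory.Quotient.preadditive E.stableRel E.stableRel_add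

/-- The quotient functor `C ⥤ C/ω`. -/
abbrev toStable : C ⥤ E.Stable := CategoryTheory.Quotient.functor E.stableRel

/-- The image `I/ω` in the stable category of a class `I` of morphisms. -/
def stableImage (I : MorphismProperty C) : MorphismProperty E.Stable :=
  fun X Y f => ∃ g : X.as ⟶ Y.as, I g ∧ E.toStable.map g = f

section Shift

variable [hE : E.IsFrobenius]

lemma exists_hull (A : C) : ∃ (I D : C) (m : A ⟶ I) (p : I ⟶ D), E.IsInj I ∧ E.Conf m p := by
  obtain ⟨I, m, hI, D, p, h⟩ := hE.enough_inj A
  exact ⟨I, D, m, p, hI, h⟩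

/-- A chosen injective object `I` in a conflation `A ⟶ I ⟶ T A`. -/
noncomputable def hull (A : C) : C := (E.exists_hull A).choose

/-- The object `T A` in the chosen conflation `A ⟶ I ⟶ T A`. -/
noncomputable def cosyz (A : C) : C := (E.exists_hull A).choose_spec.choose

/-- The inflation in the chosen conflation `A ⟶ I ⟶ T A`. -/
noncomputable def hullι (A : C) : A ⟶ E.hull A := (E.exists_hull A).choose_spec.choose_spec.choose

/-- The deflation in the chosen conflation `A ⟶ I ⟶ T A`. -/
noncomputable def hullπ (A : C) : E.hull A ⟶ E.cosyz A :=
  (E.exists_hull A).choose_spec.choose_spec.choose_spec.choose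

lemma hull_isInj (A : C) : E.IsInj (E.hull A) :=
  (E.exists_hull A).choose_spec.choose_spec.choose_spec.choose_spec.1

lemma hull_conf (A : C) : E.Conf (E.hullι A) (E.hullπ A) :=
  (E.exists_hull A).choose_spec.choose_spec.choose_spec.choose_spec.2

/-- `t : T A ⟶ T B` is induced by `u : A ⟶ B`, through a morphism of the chosen conflations. -/
def IsInduced {A B : C} (u : A ⟶ B) (t : E.cosyz A ⟶ E.cosyz B) : Prop :=
  ∃ i : E.hull A ⟶ E.hull B, E.hullι A ≫ i = u ≫ E.hullι B ∧ E.hullπ A ≫ t = i ≫ E.hullπ B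

lemma exists_isInduced {A B : C} (u : A ⟶ B) : ∃ t, E.IsInduced u t := by
  obtain ⟨i, hi⟩ := (E.hull_isInj B).exists_extend ⟨_, _, E.hull_conf A⟩ (u ≫ E.hullι B)
  obtain ⟨t, ht⟩ := (E.hull_conf A).exists_desc (i ≫ E.hullπ B) (by
    rw [← Category.assoc, hi, Category.assoc, E.zero (E.hull_conf B), comp_zero])
  exact ⟨t, i, hi, ht⟩

lemma IsInduced.stableRel {E : ExactStructure C} [hE : E.IsFrobenius] {A B : C} {u u' : A ⟶ B}
    {t t' : E.cosyz A ⟶ E.cosyz B} (h : E.IsInduced u t) (h' : E.IsInduced u' t')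
    (hu : E.stableRel u u') : E.stableRel t t' := by
  obtain ⟨i, h1, h2⟩ := h
  obtain ⟨i', h1', h2'⟩ := h'
  obtain ⟨P, s, r, hP, hsr⟩ := hu
  obtain ⟨s', hs'⟩ := ((hE.proj_iff_inj P).1 hP).exists_extend ⟨_, _, E.hull_conf A⟩ s
  obtain ⟨k, hk⟩ := (E.hull_conf A).exists_desc (i - i' - s' ≫ r ≫ E.hullι B) (by
    rw [Preadditive.comp_sub, Preadditive.comp_sub, h1, h1', ← Preadditive.sub_comp, hsr,
      ← Category.assoc (E.hullι A), hs', Category.assoc, sub_self])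
  refine ⟨E.hull B, k, E.hullπ B, (hE.proj_iff_inj _).2 (E.hull_isInj B), ?_⟩
  apply (E.hull_conf A).ext_desc
  rw [← Category.assoc, hk, Preadditive.comp_sub, h2, h2', Preadditive.sub_comp,
    Preadditive.sub_comp, Category.assoc, Category.assoc, E.zero (E.hull_conf B), comp_zero,
    comp_zero, sub_zero]

/-- A morphism `T A ⟶ T B` induced by `u : A ⟶ B`; it is unique in the stable category. -/
noncomputable def cosyzMap {A B : C} (u : A ⟶ B) : E.cosyz A ⟶ E.cosyz B :=
  (E.exists_isInduced u).choose

lemma cosyzMap_isInduced {A B : C} (u : A ⟶ B) : E.IsInduced u (E.cosyzMap u) :=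
  (E.exists_isInduced u).choose_spec

lemma IsInduced.toStable_map {E : ExactStructure C} [hE : E.IsFrobenius] {A B : C} {u u' : A ⟶ B}
    {t t' : E.cosyz A ⟶ E.cosyz B} (h : E.IsInduced u t) (h' : E.IsInduced u' t')
    (hu : E.stableRel u u') : E.toStable.map t = E.toStable.map t' :=
  CategoryTheory.Quotient.sound _ (h.stableRel h' hu)

/-- The functor `C ⥤ C/ω` sending `A` to `T A`. -/
noncomputable def preShift : C ⥤ E.Stable where
  obj A := E.toStable.obj (E.cosyz A)
  map u := E.toStable.map (E.cosyzMap u)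
  map_id A := by
    rw [← E.toStable.map_id]
    exact (E.cosyzMap_isInduced (𝟙 A)).toStable_map ⟨𝟙 _, by simp, by simp⟩
      ((stableRel_congruence E).equivalence.refl _)
  map_comp {X Y Z} f g := by
    rw [← E.toStable.map_comp]
    obtain ⟨i, h1, h2⟩ := E.cosyzMap_isInduced f
    obtain ⟨j, h3, h4⟩ := E.cosyzMap_isInduced g
    refine (E.cosyzMap_isInduced (f ≫ g)).toStable_map ⟨i ≫ j, ?_, ?_⟩
      ((stableRel_congruence E).equivalence.refl _)
    · rw [← Category.assoc, h1, Category.assoc, h3, Category.assoc]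
    · rw [← Category.assoc, h2, Category.assoc, h4, Category.assoc]

/-- The shift functor `[1] = T` of the stable category. -/
noncomputable def shift : E.Stable ⥤ E.Stable :=
  CategoryTheory.Quotient.lift _ E.preShift (fun _ _ f g h =>
    (E.cosyzMap_isInduced f).toStable_map (E.cosyzMap_isInduced g) h)

/-- The morphisms `v : Y ⟶ Z` and `w : Z ⟶ T X` of the exact category are obtained from
`u : X ⟶ Y` by a morphism of conflations
```
X ⟶ I ⟶ T X
↓u   ↓     ‖
Y ⟶ Z ⟶ T X
   v    w
```
so that the image of `(u, v, w)` in the stable category is a standard triangle. -/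
def IsStandard {X Y Z : C} (u : X ⟶ Y) (v : Y ⟶ Z) (w : Z ⟶ E.cosyz X) : Prop :=
  E.Conf v w ∧ ∃ i : E.hull X ⟶ Z, E.hullι X ≫ i = u ≫ v ∧ i ≫ w = E.hullπ X

/-- The sequence `X ⟶ Y ⟶ Z ⟶ X[1]` in the stable category is a distinguished triangle, that is,
isomorphic to a standard triangle. -/
def IsDistinguished {X Y Z : E.Stable} (u : X ⟶ Y) (v : Y ⟶ Z) (w : Z ⟶ E.shift.obj X) : Prop :=
  ∃ (X₀ Y₀ Z₀ : C) (u₀ : X₀ ⟶ Y₀) (v₀ : Y₀ ⟶ Z₀) (w₀ : Z₀ ⟶ E.cosyz X₀)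
    (a : E.toStable.obj X₀ ≅ X) (b : E.toStable.obj Y₀ ≅ Y) (c : E.toStable.obj Z₀ ≅ Z),
    E.IsStandard u₀ v₀ w₀ ∧
    E.toStable.map u₀ ≫ b.hom = a.hom ≫ u ∧
    E.toStable.map v₀ ≫ c.hom = b.hom ≫ v ∧
    (E.toStable.map w₀ : E.toStable.obj Z₀ ⟶ E.shift.obj (E.toStable.obj X₀)) ≫
      E.shift.map a.hom = c.hom ≫ w

/-- The commutative square
```
Y ⟶ Z
↓j   ↓t
B ⟶ X
```
with horizontal morphisms `h` and `f` is homotopy cartesian in the stable category: for a direct sum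
of `Z` and `B`, there is a distinguished triangle `Y ⟶ Z ⊕ B ⟶ X ⟶ Y[1]` with first morphism
`(h, j)` and second morphism `(t, -f)`. -/
def IsHomotopyCartesian {Y Z B X : E.Stable} (h : Y ⟶ Z) (j : Y ⟶ B) (t : Z ⟶ X) (f : B ⟶ X) :
    Prop :=
  h ≫ t = j ≫ f ∧
    ∃ (S : BinaryBicone Z B) (_ : Nonempty S.IsBilimit) (d : X ⟶ E.shift.obj Y),
      E.IsDistinguished (h ≫ S.inl + j ≫ S.inr) (S.fst ≫ t - S.snd ≫ f) d

/-! ### Ideal cotorsion pairs in the stable category -/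

/-- `f` is left orthogonal to `g` in the stable category: `g[1] φ f = 0` for all `φ : A ⟶ B[1]`. -/
def StableOrthogonal {X A B Y : E.Stable} (f : X ⟶ A) (g : B ⟶ Y) : Prop :=
  ∀ φ : A ⟶ E.shift.obj B, f ≫ φ ≫ E.shift.map g = 0

/-- `ᗮM` in the stable category. -/
def stableLeftPerp (M : MorphismProperty E.Stable) : MorphismProperty E.Stable :=
  fun _ _ f => ∀ ⦃B Y : E.Stable⦄ (m : B ⟶ Y), M m → E.StableOrthogonal f m

/-- `Mᗮ` in the stable category. -/
def stableRightPerp (M : MorphismProperty E.Stable) : MorphismProperty E.Stable :=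
  fun _ _ g => ∀ ⦃X A : E.Stable⦄ (m : X ⟶ A), M m → E.StableOrthogonal m g

/-- `(I, J)` is an ideal cotorsion pair in the stable category. -/
structure IsStableIdealCotorsionPair (I J : MorphismProperty E.Stable) : Prop where
  left_ideal : IsMorphismIdeal I
  right_ideal : IsMorphismIdeal J
  left_eq : I = E.stableLeftPerp J
  right_eq : J = E.stableRightPerp I

/-- `i : X ⟶ A` is a special `I`-precover in the stable category: it is an `I`-precover which fits
in a homotopy pushout diagram, that is, a morphism of distinguished triangles
```
Y ⟶ Z ⟶ A ⟶ Y[1]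
↓j   ↓t    ‖    ↓j[1]
B ⟶ X ⟶ A ⟶ B[1]
        i
```
whose left square is homotopy cartesian, with `j ∈ Iᗮ`. -/
def IsStableSpecialPrecover (I : MorphismProperty E.Stable) {X A : E.Stable} (i : X ⟶ A) : Prop :=
  IsPrecover I i ∧
    ∃ (Y Z B : E.Stable) (h : Y ⟶ Z) (q : Z ⟶ A) (φ : A ⟶ E.shift.obj Y)
      (f : B ⟶ X) (ψ : A ⟶ E.shift.obj B) (j : Y ⟶ B) (t : Z ⟶ X),
      E.IsDistinguished h q φ ∧ E.IsDistinguished f i ψ ∧ t ≫ i = q ∧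
      φ ≫ E.shift.map j = ψ ∧ E.IsHomotopyCartesian h j t f ∧ E.stableRightPerp I j

/-- `e : A ⟶ X` is a special `J`-preenvelope in the stable category: it is a `J`-preenvelope which
fits in a homotopy pullback diagram, that is, a morphism of distinguished triangles
```
   e
A ⟶ X ⟶ B ⟶ A[1]
‖    ↓t    ↓j    ‖
A ⟶ Z ⟶ Y ⟶ A[1]
```
whose middle square is homotopy cartesian, with `j ∈ ᗮJ`. -/
def IsStableSpecialPreenvelope (J : MorphismProperty E.Stable) {A X : E.Stable} (e : A ⟶ X) :
    Prop :=
  IsPreenvelope J e ∧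
    ∃ (B Z Y : E.Stable) (f : X ⟶ B) (ψ : B ⟶ E.shift.obj A)
      (q : A ⟶ Z) (h : Z ⟶ Y) (φ : Y ⟶ E.shift.obj A) (j : B ⟶ Y) (t : X ⟶ Z),
      E.IsDistinguished e f ψ ∧ E.IsDistinguished q h φ ∧ e ≫ t = q ∧
      j ≫ φ = ψ ∧ E.IsHomotopyCartesian f t j h ∧ E.stableLeftPerp J j

/-- `(I, J)` is a complete ideal cotorsion pair in the stable category: it is an ideal cotorsion
pair, `I` is special precovering and `J` is special preenveloping. -/
structure IsStableCompleteIdealCotorsionPair (I J : MorphismProperty E.Stable) : Prop where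
  isIdealCotorsionPair : E.IsStableIdealCotorsionPair I J
  exists_precover : ∀ A : E.Stable, ∃ (X : E.Stable) (i : X ⟶ A), E.IsStableSpecialPrecover I i
  exists_preenvelope : ∀ A : E.Stable, ∃ (X : E.Stable) (e : A ⟶ X),
    E.IsStableSpecialPreenvelope J e

end Shift

end ExactStructure

/-! Everything rests on Salce's argument, run on conflations `K ⟶ P ⟶ X` with `P` both projective
and injective. Every object occurs as such a `K` and as such an `X`.

Morphisms through a projective-injective object are orthogonal to everything, so they lie in both
classes. Adding `P` therefore turns an `I`-precover of `X` into a deflation `f : A ⟶ X`, with kernel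
`L`, that receives a morphism of conflations with components `g : K ⟶ L` and `t : P ⟶ A`.
Injectivity of `P` makes every extension by `K` a pullback of `K ⟶ P ⟶ X`, so its pushout along `g`
is a pullback of `L ⟶ A ⟶ X`. The precover property then gives `g ∈ Iᗮ = J` (`right_of_precover`),
so `f` is special. The same diagram yields a conflation `K ⟶ P ⊞ L ⟶ A`, the pullback of `K ⟶ P ⟶ X`
along `f`. Its first morphism is a special `J`-preenvelope of `K` (`preenvelope_of_precover`),
because `f ∈ I = ᗮJ`. The dual constructions lead from preenvelopes back to precovers.

For the stable category, an extension of `A` by `B` corresponds to a morphism `A ⟶ T B` modulo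
projectives. This makes the two notions of orthogonality agree (`stableOrthogonal_iff`). Conflations
become distinguished triangles, and the bicartesian squares become homotopy cartesian, so
completeness descends to the quotient. Conversely, a stable precover of `X` plus a deflation onto
`X` from a projective is a precover in the exact category (`precovering_of_stable`). -/

namespace ExactStructure

section Exact

variable {C : Type u} [Category.{v} C] [Preadditive C] {E : ExactStructure C}

/-! ### Morphisms of conflations -/

/-- For a morphism of conflations that is the identity on the kernels, a morphism to the second
cokernel which lifts to the second middle term lifts to the first middle term. -/
lemma Conf.exists_lift_of_left {B M A M' A' W : C} {i : B ⟶ M} {p : M ⟶ A} {i' : B ⟶ M'}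
    {p' : M' ⟶ A'} {m : M ⟶ M'} {φ : A ⟶ A'} (h : E.Conf i p) (h' : E.Conf i' p')
    (h1 : i ≫ m = i') (h2 : m ≫ p' = p ≫ φ) (a : W ⟶ A) (y : W ⟶ M') (e : y ≫ p' = a ≫ φ) :
    ∃ s : W ⟶ M, s ≫ p = a ∧ s ≫ m = y := by
  obtain ⟨N, n, d, κ, hpb, hκ, hc⟩ := h.exists_pullback a
  -- The two morphisms `N ⟶ M'` agree over `A'`, so they differ by `δ : N ⟶ B`. Since `δ` retracts
  -- `κ`, the corrected morphism `n - δ ≫ i` kills `B` and descends to the lift.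
  obtain ⟨δ, hδ⟩ := h'.exists_lift (n ≫ m - d ≫ y) (by
    simp only [Preadditive.sub_comp, Category.assoc, h2, e]
    rw [← Category.assoc, hpb.w, Category.assoc, sub_self])
  have hκδ : κ ≫ δ = 𝟙 B := by
    apply h'.ext_lift
    rw [Category.assoc, hδ, Preadditive.comp_sub, ← Category.assoc, ← Category.assoc, hκ,
      E.zero hc, h1]
    simp
  obtain ⟨s, hs⟩ := hc.exists_desc (n - δ ≫ i) (by
    rw [Preadditive.comp_sub, ← Category.assoc, hκ, hκδ]; simp)
  refine ⟨s, ?_, ?_⟩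
  · apply hc.ext_desc
    rw [← Category.assoc, hs, Preadditive.sub_comp, Category.assoc, E.zero h, hpb.w]
    simp
  · apply hc.ext_desc
    rw [← Category.assoc, hs, Preadditive.sub_comp, Category.assoc, h1, hδ]
    simp

/-- For a morphism of conflations that is the identity on the kernels, the right square is
cartesian. -/
lemma Conf.isPullback {B M A M' A' : C} {i : B ⟶ M} {p : M ⟶ A} {i' : B ⟶ M'} {p' : M' ⟶ A'}
    {m : M ⟶ M'} {φ : A ⟶ A'} (h : E.Conf i p) (h' : E.Conf i' p') (h1 : i ≫ m = i')
    (h2 : m ≫ p' = p ≫ φ) : IsPullback m p p' φ := by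
  have lift : ∀ s : PullbackCone p' φ, ∃ x : s.pt ⟶ M, x ≫ p = s.snd ∧ x ≫ m = s.fst :=
    fun s => h.exists_lift_of_left h' h1 h2 s.snd s.fst s.condition
  refine ⟨⟨h2⟩, ⟨PullbackCone.IsLimit.mk _ (fun s => (lift s).choose)
    (fun s => (lift s).choose_spec.2) (fun s => (lift s).choose_spec.1) ?_⟩⟩
  intro s x hx1 hx2
  rw [← sub_eq_zero]
  obtain ⟨y, hy⟩ := h.exists_lift (x - (lift s).choose) (by
    rw [Preadditive.sub_comp, hx2, (lift s).choose_spec.1, sub_self])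
  have : y = 0 := by
    apply h'.ext_lift
    rw [← h1, ← Category.assoc, hy, Preadditive.sub_comp, hx1, (lift s).choose_spec.2, sub_self,
      zero_comp]
  rw [← hy, this, zero_comp]

/-- For a morphism of conflations that is the identity on the cokernels, the left square is
cocartesian. -/
lemma Conf.isPushout {K P X L A : C} {k : K ⟶ P} {p : P ⟶ X} {l : L ⟶ A} {f : A ⟶ X} {g : K ⟶ L}
    {t : P ⟶ A} (h : E.Conf k p) (h' : E.Conf l f) (h1 : k ≫ t = g ≫ l) (h2 : t ≫ f = p) :
    IsPushout k g t l := by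
  have desc : ∀ s : PushoutCocone k g, ∃ σ : A ⟶ s.pt, t ≫ σ = s.inl ∧ l ≫ σ = s.inr := by
    intro s
    -- Dual to the lifting argument above: `δ` is a section of the pushed-out conflation, and
    -- subtracting `f ≫ δ` moves `n` into its kernel.
    obtain ⟨N, n, κ, d, hpo, hd, hc⟩ := h'.exists_pushout s.inr
    obtain ⟨δ, hδ⟩ := h.exists_desc (t ≫ n - s.inl ≫ κ) (by
      rw [Preadditive.comp_sub, ← Category.assoc, ← Category.assoc, h1, s.condition,
        Category.assoc, Category.assoc, hpo.w, sub_self])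
    have hδd : δ ≫ d = 𝟙 X := by
      apply h.ext_desc
      rw [← Category.assoc, hδ, Preadditive.sub_comp, Category.assoc, Category.assoc, hd,
        E.zero hc, h2]
      simp
    obtain ⟨σ, hσ⟩ := hc.exists_lift (n - f ≫ δ) (by
      rw [Preadditive.sub_comp, Category.assoc, hδd, hd]; simp)
    refine ⟨σ, ?_, ?_⟩
    · apply hc.ext_lift
      rw [Category.assoc, hσ, Preadditive.comp_sub, ← Category.assoc t f, h2, hδ]
      simp
    · apply hc.ext_lift
      rw [Category.assoc, hσ, Preadditive.comp_sub, ← Category.assoc l f, E.zero h', hpo.w]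
      simp
  refine ⟨⟨h1⟩, ⟨PushoutCocone.IsColimit.mk _ (fun s => (desc s).choose)
    (fun s => (desc s).choose_spec.1) (fun s => (desc s).choose_spec.2) ?_⟩⟩
  intro s x hx1 hx2
  rw [← sub_eq_zero]
  obtain ⟨y, hy⟩ := h'.exists_desc (x - (desc s).choose) (by
    rw [Preadditive.comp_sub, hx2, (desc s).choose_spec.2, sub_self])
  have : y = 0 := by
    apply h.ext_desc
    rw [← h2, Category.assoc, hy, Preadditive.comp_sub, hx1, (desc s).choose_spec.1, sub_self,
      comp_zero]
  rw [← hy, this, comp_zero]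

lemma Conf.neg_right {X Y Z : C} {i : X ⟶ Y} {p : Y ⟶ Z} (h : E.Conf i p) : E.Conf i (-p) :=
  E.of_iso (Iso.refl _) (Iso.refl _) ⟨-𝟙 Z, -𝟙 Z, by simp, by simp⟩ (by simp) (by simp) h

variable [HasBinaryBiproducts C]

/-- The left square of a morphism of conflations that is the identity on the cokernels gives a
conflation. -/
lemma Conf.conf_left_square {K P X L A : C} {k : K ⟶ P} {p : P ⟶ X} {l : L ⟶ A} {f : A ⟶ X}
    {g : K ⟶ L} {t : P ⟶ A} (h : E.Conf k p) (h' : E.Conf l f) (h1 : k ≫ t = g ≫ l)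
    (h2 : t ≫ f = p) : E.Conf (biprod.lift k g) (biprod.desc t (-l)) := by
  obtain ⟨M, j, q, i, hpb, hi, hc⟩ := h.exists_pullback f
  -- `P ⊞ L` is a pullback of `p` and `f`: for a compatible pair, the first component followed by
  -- `t` differs from the second by a morphism into `L`.
  have lift : ∀ s : PullbackCone p f, ∃ x : s.pt ⟶ P ⊞ L,
      x ≫ biprod.fst = s.fst ∧ x ≫ biprod.desc t (-l) = s.snd := by
    intro s
    obtain ⟨z, hz⟩ := h'.exists_lift (s.fst ≫ t - s.snd) (by
      rw [Preadditive.sub_comp, Category.assoc, h2, s.condition, sub_self])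
    exact ⟨biprod.lift s.fst z, by simp, by simp [hz]⟩
  have hpb' : IsPullback (biprod.fst : P ⊞ L ⟶ P) (biprod.desc t (-l)) p f := by
    refine ⟨⟨?_⟩, ⟨PullbackCone.IsLimit.mk _ (fun s => (lift s).choose)
      (fun s => (lift s).choose_spec.1) (fun s => (lift s).choose_spec.2) ?_⟩⟩
    · apply biprod.hom_ext' <;> simp [h2, E.zero h']
    · intro s x hx1 hx2
      have e1 := hx1.trans (lift s).choose_spec.1.symm
      have e2 := hx2.trans (lift s).choose_spec.2.symm
      generalize (lift s).choose = y at e1 e2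
      refine biprod.hom_ext _ _ e1 ?_
      apply h'.ext_lift
      rw [biprod.desc_eq, Preadditive.comp_add, Preadditive.comp_add, ← Category.assoc,
        ← Category.assoc, e1] at e2
      simp only [← Category.assoc] at e2
      have := add_left_cancel e2
      simpa using this
  refine E.of_iso (Iso.refl _) (hpb.isoIsPullback _ _ hpb') (Iso.refl _) ?_ (by simp) hc
  apply hpb'.hom_ext
  · simp [hi]
  · simp [E.zero hc, h1]

/-- The right square of a morphism of conflations that is the identity on the kernels gives a
conflation. -/
lemma Conf.conf_right_square {K N V P X : C} {e : K ⟶ N} {c : N ⟶ V} {k : K ⟶ P} {p : P ⟶ X}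
    {t : N ⟶ P} {f : V ⟶ X} (h : E.Conf e c) (h' : E.Conf k p) (h1 : e ≫ t = k)
    (h2 : c ≫ f = t ≫ p) : E.Conf (biprod.lift c t) (biprod.desc f (-p)) := by
  obtain ⟨M, j, i, q, hpo, hq, hc⟩ := h'.exists_pushout e
  have desc : ∀ s : PushoutCocone k e, ∃ x : V ⊞ P ⟶ s.pt,
      biprod.inr ≫ x = s.inl ∧ biprod.lift c t ≫ x = s.inr := by
    intro s
    obtain ⟨z, hz⟩ := h.exists_desc (s.inr - t ≫ s.inl) (by
      rw [Preadditive.comp_sub, ← Category.assoc, h1, s.condition, sub_self])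
    exact ⟨biprod.desc z s.inl, by simp, by simp [hz]⟩
  have hpo' : IsPushout k e (biprod.inr : P ⟶ V ⊞ P) (biprod.lift c t) := by
    refine ⟨⟨?_⟩, ⟨PushoutCocone.IsColimit.mk _ (fun s => (desc s).choose)
      (fun s => (desc s).choose_spec.1) (fun s => (desc s).choose_spec.2) ?_⟩⟩
    · apply biprod.hom_ext <;> simp [h1, E.zero h]
    · intro s x hx1 hx2
      have e1 := hx1.trans (desc s).choose_spec.1.symm
      have e2 := hx2.trans (desc s).choose_spec.2.symm
      generalize (desc s).choose = y at e1 e2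
      refine biprod.hom_ext' _ _ ?_ e1
      apply h.ext_desc
      rw [biprod.lift_eq, Preadditive.add_comp, Preadditive.add_comp, Category.assoc,
        Category.assoc, Category.assoc, Category.assoc, e1] at e2
      exact add_right_cancel e2
  have hc' : E.Conf (biprod.lift c t) (biprod.desc (-f) p) := by
    refine E.of_iso (Iso.refl _) (hpo.isoIsPushout _ _ hpo') (Iso.refl _) (by simp) ?_ hc
    apply hpo.hom_ext
    · simp [hq]
    · simp [E.zero hc, h2]
  -- The pushout produces the cokernel with the opposite sign to that used for homotopy cartesian
  -- squares.
  have e : biprod.desc f (-p) = -biprod.desc (-f) p := by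
    apply biprod.hom_ext' <;> simp
  rw [e]
  exact hc'.neg_right

/-! ### Orthogonality through liftings -/

/-- The zero of `Ext` is the class of the biproduct extension, so this lets vanishing in `Ext` be
tested by sections. -/
lemma Conf.exists_iso_of_section {A B M : C} {i : B ⟶ M} {p : M ⟶ A} (h : E.Conf i p) {s : A ⟶ M}
    (hs : s ≫ p = 𝟙 A) : ∃ e : M ≅ B ⊞ A, i ≫ e.hom = biprod.inl ∧ e.hom ≫ biprod.snd = p := by
  obtain ⟨r, hr⟩ := h.exists_lift (𝟙 M - p ≫ s) (by simp [hs])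
  have hir : i ≫ r = 𝟙 B := by
    apply h.ext_lift
    rw [Category.assoc, hr, Preadditive.comp_sub, ← Category.assoc, E.zero h]
    simp
  have hsr : s ≫ r = 0 := by
    apply h.ext_lift
    rw [Category.assoc, hr, Preadditive.comp_sub, ← Category.assoc, hs]
    simp
  refine ⟨⟨biprod.lift r p, biprod.desc i s, by simp [hr], ?_⟩, ?_, by simp⟩
  · apply biprod.hom_ext' <;> apply biprod.hom_ext <;> simp [hir, hsr, hs, E.zero h]
  · apply biprod.hom_ext <;> simp [hir, E.zero h]

/-- `a` and `b` are orthogonal if and only if for every morphism `(b, j, 1)` of conflations the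
morphism `a` lifts to the middle term of the target. -/
lemma extOrthogonal_iff {A₀ A₁ B₀ B₁ : C} (a : A₀ ⟶ A₁) (b : B₀ ⟶ B₁) :
    E.ExtOrthogonal a b ↔ ∀ ⦃M M' : C⦄ (i : B₀ ⟶ M) (p : M ⟶ A₁) (i' : B₁ ⟶ M') (p' : M' ⟶ A₁)
      (j : M ⟶ M'), E.Conf i p → E.Conf i' p' → i ≫ j = b ≫ i' → j ≫ p' = p →
        ∃ s : A₀ ⟶ M', s ≫ p' = a := by
  constructor
  · intro H M M' i p i' p' j h h' h1 h2
    let ξ : E.Extension A₁ B₀ := ⟨M, i, p, h⟩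
    obtain ⟨k, hk, hkp⟩ := ξ.push_spec b
    obtain ⟨n, hn, hni⟩ := (ξ.push b).pull_spec a
    obtain ⟨e, he1, he2⟩ := Quotient.exact (H (Quotient.mk _ ξ))
    -- The chosen pushout maps to any target of a morphism `(b, j, 1)`, so a lift to the chosen one
    -- is enough.
    let x := hk.desc j i' h1
    have hx : x ≫ p' = (ξ.push b).p := by
      apply hk.hom_ext
      · simp only [x, IsPushout.inl_desc_assoc, h2]; exact hkp.symm
      · simp only [x, IsPushout.inr_desc_assoc]; rw [E.zero h', E.zero (ξ.push b).conf]
    refine ⟨biprod.inr ≫ e.inv ≫ n ≫ x, ?_⟩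
    have he3 : e.inv ≫ ((ξ.push b).pull a).p = biprod.snd := by
      rw [Iso.inv_comp_eq]; exact he2.symm
    have : biprod.inr ≫ e.inv ≫ n ≫ x ≫ p' = a := by
      rw [hx, hn.w, ← Category.assoc e.inv, he3]
      simp
    simpa using this
  · intro H ξ
    induction ξ using Quotient.inductionOn with
    | h ξ =>
      obtain ⟨k, hk, hkp⟩ := ξ.push_spec b
      obtain ⟨n, hn, hni⟩ := (ξ.push b).pull_spec a
      obtain ⟨s, hs⟩ := H ξ.i ξ.p (ξ.push b).i (ξ.push b).p k ξ.conf (ξ.push b).conf hk.w hkp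
      -- A lift of `a`, paired with the identity of `A₀`, is a section of the pullback along `a`.
      obtain ⟨e, he⟩ := ((ξ.push b).pull a).conf.exists_iso_of_section
        (s := hn.lift s (𝟙 _) (by simp [hs])) (by simp)
      exact Quotient.sound ⟨e, he⟩

lemma extOrthogonal_of_proj {A₀ A₁ B₀ B₁ P : C} (hP : E.IsProj P) (s : A₀ ⟶ P) (t : P ⟶ A₁)
    (b : B₀ ⟶ B₁) : E.ExtOrthogonal (s ≫ t) b := by
  rw [extOrthogonal_iff]
  intro M M' i p i' p' j _ h' _ _
  obtain ⟨t', ht'⟩ := hP.exists_lift ⟨_, _, h'⟩ t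
  exact ⟨s ≫ t', by rw [Category.assoc, ht']⟩

/-- Since `s` extends over the middle term of any extension by `B₀`, pushing that extension out
along `s ≫ t` splits it. -/
lemma extOrthogonal_of_inj {A₀ A₁ B₀ B₁ P : C} (hP : E.IsInj P) (a : A₀ ⟶ A₁) (s : B₀ ⟶ P)
    (t : P ⟶ B₁) : E.ExtOrthogonal a (s ≫ t) := by
  rw [extOrthogonal_iff]
  intro M M' i p i' p' j h h' h1 h2
  obtain ⟨s', hs'⟩ := hP.exists_extend ⟨_, _, h⟩ s
  obtain ⟨σ, hσ⟩ := h.exists_desc (j - s' ≫ t ≫ i') (by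
    rw [Preadditive.comp_sub, h1, ← Category.assoc i, hs', Category.assoc, sub_self])
  refine ⟨a ≫ σ, ?_⟩
  have : σ ≫ p' = 𝟙 _ := by
    apply h.ext_desc
    rw [← Category.assoc, hσ, Preadditive.sub_comp, h2]
    simp [E.zero h']
  rw [Category.assoc, this, Category.comp_id]

end Exact

/-! ### Conflations with projective-injective middle term -/

section Frobenius

variable {C : Type u} [Category.{v} C] [Preadditive C] {E : ExactStructure C} [hE : E.IsFrobenius]

lemma IsFrobenius.exists_proj_conf (X : C) :
    ∃ (K P : C) (k : K ⟶ P) (p : P ⟶ X), E.IsProj P ∧ E.IsInj P ∧ E.Conf k p := by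
  obtain ⟨P, p, hP, K, k, h⟩ := hE.enough_proj X
  exact ⟨K, P, k, p, hP, (hE.proj_iff_inj P).1 hP, h⟩

lemma IsFrobenius.exists_inj_conf (K : C) :
    ∃ (P X : C) (k : K ⟶ P) (p : P ⟶ X), E.IsProj P ∧ E.IsInj P ∧ E.Conf k p := by
  obtain ⟨P, k, hP, X, p, h⟩ := hE.enough_inj K
  exact ⟨P, X, k, p, (hE.proj_iff_inj P).2 hP, hP, h⟩

end Frobenius

section Complete

variable {C : Type u} [Category.{v} C] [Preadditive C] [HasBinaryBiproducts C]
  {E : ExactStructure C}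

/-! ### Precovers and preenvelopes in the exact category -/

lemma _root_.IsMorphismIdeal.comp_left {D : Type u} [Category.{v} D] [Preadditive D]
    {I : MorphismProperty D} (hI : IsMorphismIdeal I) {X A B : D} (h : X ⟶ A) {g : A ⟶ B}
    (hg : I g) : I (h ≫ g) := by
  simpa using hI.comp_mem h g (𝟙 B) hg

lemma _root_.IsMorphismIdeal.comp_right {D : Type u} [Category.{v} D] [Preadditive D]
    {I : MorphismProperty D} (hI : IsMorphismIdeal I) {A B Y : D} {g : A ⟶ B} (hg : I g)
    (f : B ⟶ Y) : I (g ≫ f) := by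
  simpa using hI.comp_mem (𝟙 A) g f hg

lemma _root_.IsMorphismIdeal.desc_mem {D : Type u} [Category.{v} D] [Preadditive D]
    [HasBinaryBiproducts D] {I : MorphismProperty D} (hI : IsMorphismIdeal I) {A B X : D}
    {f : A ⟶ X} {g : B ⟶ X} (hf : I f) (hg : I g) : I (biprod.desc f g) := by
  rw [biprod.desc_eq]
  exact hI.add_mem _ _ (hI.comp_left _ hf) (hI.comp_left _ hg)

lemma _root_.IsMorphismIdeal.lift_mem {D : Type u} [Category.{v} D] [Preadditive D]
    [HasBinaryBiproducts D] {I : MorphismProperty D} (hI : IsMorphismIdeal I) {A B X : D}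
    {f : X ⟶ A} {g : X ⟶ B} (hf : I f) (hg : I g) : I (biprod.lift f g) := by
  rw [biprod.lift_eq]
  exact hI.add_mem _ _ (hI.comp_right hf _) (hI.comp_right hg _)

/-- Pulling back along `f` gives a morphism of conflations that is the identity on kernels, and its
right square is a conflation. Starting from `-p` cancels the sign in that conflation. -/
lemma deflation_desc {A P X : C} (f : A ⟶ X) {p : P ⟶ X} (hp : E.Deflation p) :
    E.Deflation (biprod.desc f p) := by
  obtain ⟨K, k, h⟩ := hp
  obtain ⟨M, j, q, i, hpb, hi, hc⟩ := h.neg_right.exists_pullback f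
  exact ⟨_, _, by simpa using hc.conf_right_square h.neg_right hi hpb.w.symm⟩

lemma inflation_lift {K P N : C} {k : K ⟶ P} (hk : E.Inflation k) (g : K ⟶ N) :
    E.Inflation (biprod.lift k g) := by
  obtain ⟨X, p, h⟩ := hk
  obtain ⟨M, j, i, q, hpo, hq, hc⟩ := h.exists_pushout g
  exact ⟨_, _, h.conf_left_square hc hpo.w hq⟩

variable {I J : MorphismProperty C}

/-- Permits adding a projective summand to the source of a precover without leaving `I`. -/
lemma IsIdealCotorsionPair.left_of_proj (h : E.IsIdealCotorsionPair I J) {X Y P : C}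
    (hP : E.IsProj P) (s : X ⟶ P) (t : P ⟶ Y) : I (s ≫ t) := by
  rw [h.left_eq]
  exact fun _ _ b _ => extOrthogonal_of_proj hP s t b

lemma IsIdealCotorsionPair.right_of_inj (h : E.IsIdealCotorsionPair I J) {X Y P : C}
    (hP : E.IsInj P) (s : X ⟶ P) (t : P ⟶ Y) : J (s ≫ t) := by
  rw [h.right_eq]
  exact fun _ _ a _ => extOrthogonal_of_inj hP a s t

lemma IsIdealCotorsionPair.orthogonal (h : E.IsIdealCotorsionPair I J) {A₀ A₁ B₀ B₁ : C}
    {a : A₀ ⟶ A₁} {b : B₀ ⟶ B₁} (ha : I a) (hb : J b) : E.ExtOrthogonal a b := by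
  rw [h.left_eq] at ha
  exact ha b hb

/-- If `f` is a precover and a deflation, then the morphism from a syzygy of its target to its kernel
lies in the right class. -/
lemma IsIdealCotorsionPair.right_of_precover (h : E.IsIdealCotorsionPair I J)
    {K P X L A : C} {k : K ⟶ P} {p : P ⟶ X} {l : L ⟶ A} {f : A ⟶ X} {g : K ⟶ L} {t : P ⟶ A}
    (hf : IsPrecover I f) (hP : E.IsInj P) (hk : E.Conf k p) (hl : E.Conf l f)
    (h1 : k ≫ t = g ≫ l) (h2 : t ≫ f = p) : J g := by
  rw [h.right_eq]
  intro W V a ha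
  rw [extOrthogonal_iff]
  intro M M' i q i' q' j hM hM' e1 e2
  -- Injectivity of `P` exhibits the given extension as the pullback of `K ⟶ P ⟶ X` along `χ`.
  obtain ⟨m, hm⟩ := hP.exists_extend ⟨_, _, hM⟩ k
  obtain ⟨χ, hχ⟩ := hM.exists_desc (m ≫ p) (by rw [← Category.assoc, hm, E.zero hk])
  obtain ⟨s, hs⟩ := hf.2 (a ≫ χ) (h.left_ideal.comp_right ha χ)
  have hpo := hM.isPushout hM' e1 e2
  -- Through `x`, the pushout along `g` is the pullback of `L ⟶ A ⟶ X` along `χ`, so the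
  -- factorization `s` of `a ≫ χ` through `f` lifts `a` to `M'`.
  obtain ⟨x, hx1, hx2⟩ : ∃ x : M' ⟶ A, j ≫ x = m ≫ t ∧ i' ≫ x = l :=
    ⟨hpo.desc (m ≫ t) l (by rw [← Category.assoc, hm, h1]), by simp, by simp⟩
  have e3 : x ≫ f = q' ≫ χ := by
    apply hpo.hom_ext
    · rw [← Category.assoc, hx1, Category.assoc, h2, ← Category.assoc, e2, hχ]
    · rw [← Category.assoc, hx2, E.zero hl, ← Category.assoc, E.zero hM', zero_comp]
  obtain ⟨y, hy, -⟩ := hM'.exists_lift_of_left hl hx2 e3 a s hs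
  exact ⟨y, hy⟩

/-- If `e` is a preenvelope and an inflation, then the morphism from its cokernel to a cosyzygy of
its source lies in the left class. -/
lemma IsIdealCotorsionPair.left_of_preenvelope (h : E.IsIdealCotorsionPair I J)
    {K N V P X : C} {e : K ⟶ N} {c : N ⟶ V} {k : K ⟶ P} {p : P ⟶ X} {t : N ⟶ P} {f : V ⟶ X}
    (he : IsPreenvelope J e) (hP : E.IsProj P) (hc : E.Conf e c) (hk : E.Conf k p)
    (h1 : e ≫ t = k) (h2 : c ≫ f = t ≫ p) : I f := by
  rw [h.left_eq]
  intro B₀ B₁ b hb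
  rw [extOrthogonal_iff]
  intro M M' i q i' q' j hM hM' e1 e2
  -- Projectivity of `P` exhibits the given extension as the pushout of `K ⟶ P ⟶ X` along `y`. As `y
  -- ≫ b` factors through `e`, the difference below vanishes on `K` and descends to a lift of `f`.
  obtain ⟨s, hs⟩ := hP.exists_lift ⟨_, _, hM⟩ p
  obtain ⟨y, hy⟩ := hM.exists_lift (k ≫ s) (by rw [Category.assoc, hs, E.zero hk])
  obtain ⟨z, hz⟩ := he.2 (y ≫ b) (h.right_ideal.comp_left y hb)
  obtain ⟨σ, hσ⟩ := hc.exists_desc (t ≫ s ≫ j - z ≫ i') (by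
    rw [Preadditive.comp_sub, ← Category.assoc e t, h1, ← Category.assoc k, ← hy, Category.assoc,
      e1, ← Category.assoc e z, hz, Category.assoc, sub_self])
  refine ⟨σ, ?_⟩
  apply hc.ext_desc
  rw [← Category.assoc, hσ, Preadditive.sub_comp]
  simp [E.zero hM', e2, hs, h2]

/-- Given a precover which is a deflation, the morphism from a syzygy to its pushout with the
projective cover is a preenvelope. -/
lemma IsIdealCotorsionPair.preenvelope_of_precover (h : E.IsIdealCotorsionPair I J)
    {K P X L A : C} {k : K ⟶ P} {p : P ⟶ X} {l : L ⟶ A} {f : A ⟶ X} {g : K ⟶ L} {t : P ⟶ A}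
    (hf : IsPrecover I f) (hP : E.IsInj P) (hk : E.Conf k p) (hl : E.Conf l f)
    (h1 : k ≫ t = g ≫ l) (h2 : t ≫ f = p) : IsPreenvelope J (biprod.lift k g) := by
  refine ⟨h.right_ideal.lift_mem (by simpa using h.right_of_inj hP k (𝟙 P))
    (h.right_of_precover hf hP hk hl h1 h2), ?_⟩
  intro Y y hy
  obtain ⟨M, j, i, q, hpo, hq, hM⟩ := hk.exists_pushout y
  obtain ⟨s, hs⟩ := (extOrthogonal_iff f y).1 (h.orthogonal hf.1 hy) k p i q j hk hM hpo.w hq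
  obtain ⟨y', hy'⟩ := hM.exists_lift (l ≫ s) (by rw [Category.assoc, hs, E.zero hl])
  -- `t ≫ s` and `j` both lift `p` to `M`, so they differ by `δ : P ⟶ Y`. On `K`, subtracting `k ≫
  -- δ` corrects `g ≫ y'` to `y`.
  obtain ⟨δ, hδ⟩ := hM.exists_lift (t ≫ s - j) (by
    rw [Preadditive.sub_comp, Category.assoc, hs, h2, hq, sub_self])
  refine ⟨biprod.desc (-δ) y', ?_⟩
  apply hM.ext_lift
  simp only [biprod.lift_desc, Preadditive.add_comp, Preadditive.comp_neg, Preadditive.neg_comp,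
    Category.assoc, hδ, hy', Preadditive.comp_sub]
  rw [← Category.assoc k t, h1, Category.assoc, hpo.w]
  abel

/-- Given a preenvelope which is an inflation, the morphism to a cosyzygy from its pullback with the
injective hull is a precover. -/
lemma IsIdealCotorsionPair.precover_of_preenvelope (h : E.IsIdealCotorsionPair I J)
    {K N V P X : C} {e : K ⟶ N} {c : N ⟶ V} {k : K ⟶ P} {p : P ⟶ X} {t : N ⟶ P} {f : V ⟶ X}
    (he : IsPreenvelope J e) (hP : E.IsProj P) (hc : E.Conf e c) (hk : E.Conf k p)
    (h1 : e ≫ t = k) (h2 : c ≫ f = t ≫ p) : IsPrecover I (biprod.desc f p) := by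
  refine ⟨h.left_ideal.desc_mem (h.left_of_preenvelope he hP hc hk h1 h2)
    (by simpa using h.left_of_proj hP (𝟙 P) p), ?_⟩
  intro W a ha
  obtain ⟨M, j, i, q, hpo, hq, hM⟩ := hk.exists_pushout e
  obtain ⟨s, hs⟩ := (extOrthogonal_iff a e).1 (h.orthogonal ha he.1) k p i q j hk hM hpo.w hq
  -- Because `t` extends `k` to `N`, the morphism `j` splits. In the coordinates `x` and `y`, the
  -- deflation `q` reads `x ≫ p - y ≫ f`, which turns the lift `s` of `a` into the factorization.
  obtain ⟨x, hx1, hx2⟩ : ∃ x : M ⟶ P, j ≫ x = 𝟙 P ∧ i ≫ x = t :=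
    ⟨hpo.desc (𝟙 P) t (by simp [h1]), by simp, by simp⟩
  obtain ⟨y, hy1, hy2⟩ : ∃ y : M ⟶ V, j ≫ y = 0 ∧ i ≫ y = c :=
    ⟨hpo.desc 0 c (by simp [E.zero hc]), by simp, by simp⟩
  have key : q = x ≫ p - y ≫ f := by
    apply hpo.hom_ext
    · simp [reassoc_of% hx1, reassoc_of% hy1, hq]
    · simp [reassoc_of% hx2, reassoc_of% hy2, E.zero hM, h2]
  refine ⟨biprod.lift (-(s ≫ y)) (s ≫ x), ?_⟩
  rw [← hs, key]
  simp [sub_eq_neg_add]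

/-- For a conflation `K ⟶ P ⟶ X` with `P` projective, an `I`-precover of `X` can be replaced by one
which is a deflation and receives a morphism of conflations. -/
lemma IsIdealCotorsionPair.exists_deflation_precover (h : E.IsIdealCotorsionPair I J)
    {K P X : C} {k : K ⟶ P} {p : P ⟶ X} (hP : E.IsProj P) (hk : E.Conf k p)
    (hX : ∃ (A : C) (f : A ⟶ X), IsPrecover I f) :
    ∃ (L A : C) (l : L ⟶ A) (f : A ⟶ X) (g : K ⟶ L) (t : P ⟶ A), IsPrecover I f ∧ E.Conf l f ∧
      k ≫ t = g ≫ l ∧ t ≫ f = p := by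
  obtain ⟨A, f, hf⟩ := hX
  obtain ⟨L, l, hl⟩ := deflation_desc f ⟨_, _, hk⟩
  obtain ⟨g, hg⟩ := hl.exists_lift (k ≫ biprod.inr) (by simp [E.zero hk])
  refine ⟨L, _, l, _, g, biprod.inr, ⟨h.left_ideal.desc_mem hf.1
    (by simpa using h.left_of_proj hP (𝟙 P) p), ?_⟩, hl, hg.symm, by simp⟩
  intro W a ha
  obtain ⟨s, hs⟩ := hf.2 a ha
  exact ⟨s ≫ biprod.inl, by simp [hs]⟩

variable [hE : E.IsFrobenius]

lemma IsIdealCotorsionPair.complete_of_precovering (h : E.IsIdealCotorsionPair I J)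
    (hI : IsPrecovering I) : E.IsCompleteIdealCotorsionPair I J := by
  refine ⟨h, ?_, ?_⟩
  · intro K
    obtain ⟨P, X, k, p, hP, hP', hk⟩ := IsFrobenius.exists_inj_conf (E := E) K
    obtain ⟨L, A, l, f, g, t, hf, hl, h1, h2⟩ := h.exists_deflation_precover hP hk (hI X)
    -- The morphism of `ᗮJ` required for specialness is the precover `f` itself.
    refine ⟨_, _, h.preenvelope_of_precover hf hP' hk hl h1 h2, A, P, X, _, k, p, f, biprod.fst,
      hk.conf_left_square hl h1 h2, hk, ?_, by simp, ?_⟩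
    · refine (hk.conf_left_square hl h1 h2).isPullback hk (by simp) ?_
      apply biprod.hom_ext' <;> simp [h2, E.zero hl]
    · rw [← h.left_eq]; exact hf.1
  · intro X
    obtain ⟨K, P, k, p, hP, hP', hk⟩ := IsFrobenius.exists_proj_conf (E := E) X
    obtain ⟨L, A, l, f, g, t, hf, hl, h1, h2⟩ := h.exists_deflation_precover hP hk (hI X)
    refine ⟨A, f, hf, K, P, L, k, p, l, g, t, hk, hl, hk.isPushout hl h1 h2, h2, ?_⟩
    rw [← h.right_eq]
    exact h.right_of_precover hf hP' hk hl h1 h2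

lemma IsIdealCotorsionPair.precovering_of_preenveloping (h : E.IsIdealCotorsionPair I J)
    (hJ : IsPreenveloping J) : IsPrecovering I := by
  intro X
  obtain ⟨K, P, k, p, hP, hP', hk⟩ := IsFrobenius.exists_proj_conf (E := E) X
  obtain ⟨N, e, he⟩ := hJ K
  -- Adding the component `k`, which lies in `J` because it factors through the injective `P`, makes
  -- the preenvelope an inflation.
  have he' : IsPreenvelope J (biprod.lift k e) := by
    refine ⟨h.right_ideal.lift_mem (by simpa using h.right_of_inj hP' k (𝟙 P)) he.1, ?_⟩
    intro Y y hy
    obtain ⟨z, hz⟩ := he.2 y hy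
    exact ⟨biprod.snd ≫ z, by simp [hz]⟩
  obtain ⟨V, c, hc⟩ := inflation_lift ⟨_, _, hk⟩ e
  obtain ⟨f, hf⟩ := hc.exists_desc (biprod.fst ≫ p) (by simp [E.zero hk])
  exact ⟨_, _, h.precover_of_preenvelope he' hP hc hk (by simp) hf⟩

end Complete

section Connecting

variable {C : Type u} [Category.{v} C] [Preadditive C] [HasZeroObject C] [HasBinaryBiproducts C]
  {E : ExactStructure C} [E.IsFrobenius]

/-! ### Connecting morphisms of conflations -/

variable (E) in
/-- `φ : A ⟶ T B` is induced by a morphism from the conflation `B ⟶ M ⟶ A` to the chosen conflation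
`B ⟶ I ⟶ T B` which is the identity on `B`. -/
def IsConnecting {B M A : C} (i : B ⟶ M) (p : M ⟶ A) (φ : A ⟶ E.cosyz B) : Prop :=
  ∃ m : M ⟶ E.hull B, i ≫ m = E.hullι B ∧ m ≫ E.hullπ B = p ≫ φ

lemma Conf.exists_isConnecting {B M A : C} {i : B ⟶ M} {p : M ⟶ A} (h : E.Conf i p) :
    ∃ φ, E.IsConnecting i p φ := by
  obtain ⟨m, hm⟩ := (E.hull_isInj B).exists_extend ⟨_, _, h⟩ (E.hullι B)
  obtain ⟨φ, hφ⟩ := h.exists_desc (m ≫ E.hullπ B) (by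
    rw [← Category.assoc, hm, E.zero (E.hull_conf B)])
  exact ⟨φ, m, hm, hφ.symm⟩

/-- Every morphism `A ⟶ T B` is the connecting morphism of a conflation. -/
lemma exists_conf_isConnecting {A B : C} (φ : A ⟶ E.cosyz B) :
    ∃ (M : C) (i : B ⟶ M) (p : M ⟶ A), E.Conf i p ∧ E.IsConnecting i p φ := by
  obtain ⟨M, m, p, i, hpb, hi, hc⟩ := (E.hull_conf B).exists_pullback φ
  exact ⟨M, i, p, hc, m, hi, hpb.w⟩

/-- Connecting morphisms are natural in the stable category. -/
lemma IsConnecting.stableRel {B M A B' M' A' : C} {i : B ⟶ M} {p : M ⟶ A} {i' : B' ⟶ M'}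
    {p' : M' ⟶ A'} {φ : A ⟶ E.cosyz B} {φ' : A' ⟶ E.cosyz B'} {b : B ⟶ B'} {j : M ⟶ M'}
    {c : A ⟶ A'} {τ : E.cosyz B ⟶ E.cosyz B'} (h : E.Conf i p) (hφ : E.IsConnecting i p φ)
    (hφ' : E.IsConnecting i' p' φ') (h1 : i ≫ j = b ≫ i') (h2 : j ≫ p' = p ≫ c)
    (hτ : E.IsInduced b τ) : E.stableRel (c ≫ φ') (φ ≫ τ) := by
  obtain ⟨m, hm1, hm2⟩ := hφ
  obtain ⟨m', hm1', hm2'⟩ := hφ'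
  obtain ⟨n, hn1, hn2⟩ := hτ
  -- The two morphisms from `M` to the hull of `B'` agree on `B`. Their difference descends to `θ`,
  -- through which the difference of the two composites factors.
  obtain ⟨θ, hθ⟩ := h.exists_desc (j ≫ m' - m ≫ n) (by
    rw [Preadditive.comp_sub, ← Category.assoc, h1, Category.assoc, hm1', ← Category.assoc, hm1,
      hn1, sub_self])
  refine ⟨E.hull B', θ, E.hullπ B', (IsFrobenius.proj_iff_inj _).2 (E.hull_isInj B'), ?_⟩
  apply h.ext_desc
  rw [← Category.assoc p θ, hθ, Preadditive.comp_sub, Preadditive.sub_comp, Category.assoc,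
    Category.assoc, hm2', ← hn2, ← Category.assoc m, hm2, ← Category.assoc j, h2]
  simp only [Category.assoc]

/-- A morphism to `T B` which factors through a projective object factors through the chosen
conflation. -/
lemma exists_lift_hullπ {A B : C} {φ ψ : A ⟶ E.cosyz B} (h : E.stableRel φ ψ) :
    ∃ y : A ⟶ E.hull B, y ≫ E.hullπ B = φ - ψ := by
  obtain ⟨P, s, t, hP, e⟩ := h
  obtain ⟨t', ht'⟩ := hP.exists_lift ⟨_, _, E.hull_conf B⟩ t
  exact ⟨s ≫ t', by rw [Category.assoc, ht', e]⟩

end Connecting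

/-! ### Passage to the stable category -/

section Stable

variable {C : Type u} [Category.{v} C] [Preadditive C] {E : ExactStructure C}

lemma toStable_map_surjective {X Y : C} (f : E.toStable.obj X ⟶ E.toStable.obj Y) :
    ∃ g : X ⟶ Y, E.toStable.map g = f :=
  E.toStable.map_surjective f

lemma stableImage_map {I : MorphismProperty C} {X Y : C} {f : X ⟶ Y} (hf : I f) :
    E.stableImage I (E.toStable.map f) :=
  ⟨f, hf, rfl⟩

lemma _root_.IsPrecover.toStable_map {I : MorphismProperty C} {A X : C} {f : A ⟶ X} (hf : IsPrecover I f) :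
    IsPrecover (E.stableImage I) (E.toStable.map f) := by
  refine ⟨stableImage_map hf.1, ?_⟩
  rintro A' _ ⟨g, hg, rfl⟩
  obtain ⟨s, hs⟩ := hf.2 g hg
  refine ⟨E.toStable.map s, ?_⟩
  rw [← hs, Functor.map_comp]

lemma _root_.IsPreenvelope.toStable_map {J : MorphismProperty C}
    {A X : C} {f : X ⟶ A} (hf : IsPreenvelope J f) :
    IsPreenvelope (E.stableImage J) (E.toStable.map f) := by
  refine ⟨stableImage_map hf.1, ?_⟩
  rintro A' _ ⟨g, hg, rfl⟩
  obtain ⟨s, hs⟩ := hf.2 g hg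
  refine ⟨E.toStable.map s, ?_⟩
  rw [← hs, Functor.map_comp]

variable [HasZeroObject C] [HasBinaryBiproducts C]

instance toStable_additive : E.toStable.Additive where
  map_add := rfl

lemma toStable_map_eq_iff {X Y : C} (f g : X ⟶ Y) :
    E.toStable.map f = E.toStable.map g ↔ E.stableRel f g :=
  CategoryTheory.Quotient.functor_map_eq_iff E.stableRel f g

lemma toStable_map_eq_zero_of_proj {X Y P : C} (hP : E.IsProj P) (s : X ⟶ P) (t : P ⟶ Y) :
    E.toStable.map (s ≫ t) = 0 := by
  rw [← E.toStable.map_zero, toStable_map_eq_iff]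
  exact ⟨P, s, t, hP, by simp⟩

lemma _root_.IsMorphismIdeal.stableImage {I : MorphismProperty C} (hI : IsMorphismIdeal I) :
    IsMorphismIdeal (E.stableImage I) where
  zero_mem X Y := ⟨0, hI.zero_mem _ _, E.toStable.map_zero _ _⟩
  add_mem := by
    rintro X Y _ _ ⟨f, hf, rfl⟩ ⟨g, hg, rfl⟩
    exact ⟨f + g, hI.add_mem _ _ hf hg, E.toStable.map_add⟩
  neg_mem := by
    rintro X Y _ ⟨f, hf, rfl⟩
    exact ⟨-f, hI.neg_mem _ hf, E.toStable.map_neg⟩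
  comp_mem := by
    rintro X A B Y h _ f ⟨g, hg, rfl⟩
    obtain ⟨h, rfl⟩ := toStable_map_surjective (E := E) h
    obtain ⟨f, rfl⟩ := toStable_map_surjective (E := E) f
    refine ⟨h ≫ g ≫ f, hI.comp_mem _ _ _ hg, ?_⟩
    rw [Functor.map_comp, Functor.map_comp]

/-- The image of the binary biproduct of two objects in the stable category. -/
noncomputable def stableBicone (Z B : C) : BinaryBicone (E.toStable.obj Z) (E.toStable.obj B) :=
  E.toStable.mapBinaryBicone (BinaryBiproduct.bicone Z B)

lemma stableBicone_isBilimit (Z B : C) : Nonempty (E.stableBicone Z B).IsBilimit := by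
  refine ⟨isBinaryBilimitOfTotal _ ?_⟩
  have := congrArg E.toStable.map (biprod.total (X := Z) (Y := B))
  rw [Functor.map_add, Functor.map_comp, Functor.map_comp, E.toStable.map_id] at this
  exact this

variable [hE : E.IsFrobenius]

/-- Orthogonality in the exact category and in the stable category agree. -/
lemma stableOrthogonal_iff {A₀ A₁ B₀ B₁ : C} (a : A₀ ⟶ A₁) (b : B₀ ⟶ B₁) :
    E.StableOrthogonal (E.toStable.map a) (E.toStable.map b) ↔ E.ExtOrthogonal a b := by
  have key : E.StableOrthogonal (E.toStable.map a) (E.toStable.map b) ↔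
      ∀ φ : A₁ ⟶ E.cosyz B₀, E.stableRel (a ≫ φ ≫ E.cosyzMap b) 0 := by
    have e : ∀ φ : A₁ ⟶ E.cosyz B₀, E.stableRel (a ≫ φ ≫ E.cosyzMap b) 0 ↔
        E.toStable.map a ≫ E.toStable.map φ ≫ E.toStable.map (E.cosyzMap b) = 0 := by
      intro φ
      rw [← toStable_map_eq_iff, Functor.map_comp, Functor.map_comp, Functor.map_zero]
    constructor
    · intro H φ
      exact (e φ).2 (H (E.toStable.map φ))
    · intro H φ
      obtain ⟨φ, rfl⟩ := toStable_map_surjective (E := E) (X := A₁) (Y := E.cosyz B₀) φ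
      exact (e φ).1 (H φ)
  rw [key, extOrthogonal_iff]
  constructor
  · intro H M M' i p i' p' j h h' h1 h2
    obtain ⟨φ, hφ⟩ := h.exists_isConnecting
    obtain ⟨φ', hφ'⟩ := h'.exists_isConnecting
    obtain ⟨y, hy⟩ := exists_lift_hullπ (E := E) (H φ)
    obtain ⟨z, hz⟩ := exists_lift_hullπ (hφ.stableRel h hφ' h1 (by simpa using h2 : _ = p ≫ 𝟙 _)
      (E.cosyzMap_isInduced b))
    obtain ⟨m', hm1, hm2⟩ := hφ'
    -- `M'` is the pullback of the chosen conflation of `B₁` along `φ'`. Here `y` lifts `a ≫ φ ≫ T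
    -- b`, and `z` lifts the discrepancy between `φ'` and `φ ≫ T b`.
    obtain ⟨s, hs, -⟩ := h'.exists_lift_of_left (E.hull_conf B₁) hm1 hm2 a (y + a ≫ z) (by
      rw [Preadditive.add_comp, hy, Category.assoc, hz]
      simp)
    exact ⟨s, hs⟩
  · intro H φ
    obtain ⟨M, i, p, h, hφ⟩ := exists_conf_isConnecting φ
    obtain ⟨M', j, i', p', hpo, h2, h'⟩ := h.exists_pushout b
    obtain ⟨φ', hφ'⟩ := h'.exists_isConnecting
    -- A lift of `a` to `M'` makes `a ≫ φ'` factor through the hull of `B₁`, and `φ'` agrees stably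
    -- with `φ ≫ T b`.
    obtain ⟨s, hs⟩ := H i p i' p' j h h' hpo.w h2
    have h3 := hφ.stableRel h hφ' hpo.w (by simpa using h2 : _ = p ≫ 𝟙 _) (E.cosyzMap_isInduced b)
    rw [Category.id_comp, ← toStable_map_eq_iff] at h3
    rw [← toStable_map_eq_iff, Functor.map_comp, ← h3, ← Functor.map_comp, Functor.map_zero]
    obtain ⟨m, hm1, hm2⟩ := hφ'
    rw [← hs, Category.assoc, ← hm2, ← Category.assoc]
    exact toStable_map_eq_zero_of_proj ((hE.proj_iff_inj _).2 (E.hull_isInj _)) _ _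

/-- A conflation gives a distinguished triangle. -/
lemma Conf.isDistinguished {B M A : C} {i : B ⟶ M} {p : M ⟶ A} {φ : A ⟶ E.cosyz B}
    (h : E.Conf i p) (hφ : E.IsConnecting i p φ) :
    E.IsDistinguished (E.toStable.map i) (E.toStable.map p)
      (E.toStable.map (-φ) : E.toStable.obj A ⟶ E.toStable.obj (E.cosyz B)) := by
  obtain ⟨m, hm1, hm2⟩ := hφ
  have hP : E.IsProj (E.hull B) := (hE.proj_iff_inj _).2 (E.hull_isInj B)
  -- The standard triangle on `i` has third object `Z`. Since `m` extends the hull inclusion to `M`,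
  -- this `Z` is the hull of `B` plus `A`, and hence stably isomorphic to `A` through `z`.
  obtain ⟨Z, n, v, w, hpo, hw, hc⟩ := (E.hull_conf B).exists_pushout i
  obtain ⟨z, hz1, hz2⟩ : ∃ z : Z ⟶ A, n ≫ z = 0 ∧ v ≫ z = p :=
    ⟨hpo.desc 0 p (by simp [E.zero h]), by simp, by simp⟩
  obtain ⟨r, hr1, hr2⟩ : ∃ r : Z ⟶ E.hull B, n ≫ r = 𝟙 _ ∧ v ≫ r = m :=
    ⟨hpo.desc (𝟙 _) m (by simp [hm1]), by simp, by simp⟩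
  obtain ⟨σ, hσ⟩ := h.exists_desc (v - m ≫ n) (by
    rw [Preadditive.comp_sub, ← hpo.w, ← Category.assoc i m, hm1, sub_self])
  have hσz : σ ≫ z = 𝟙 A := by
    apply h.ext_desc
    rw [← Category.assoc, hσ, Preadditive.sub_comp, hz2, Category.assoc, hz1]
    simp
  have hzσ : z ≫ σ = 𝟙 Z - r ≫ n := by
    apply hpo.hom_ext
    · simp [reassoc_of% hz1, reassoc_of% hr1]
    · simp [reassoc_of% hz2, reassoc_of% hr2, hσ]
  -- Stably `w = -(z ≫ φ)`, which is the source of the sign on the connecting morphism.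
  have hwφ : w + z ≫ φ = r ≫ E.hullπ B := by
    apply hpo.hom_ext
    · simp [reassoc_of% hz1, reassoc_of% hr1, hw]
    · simp [reassoc_of% hz2, reassoc_of% hr2, hm2, E.zero hc]
  let c : E.toStable.obj Z ≅ E.toStable.obj A :=
    { hom := E.toStable.map z
      inv := E.toStable.map σ
      hom_inv_id := by
        rw [← Functor.map_comp, hzσ, Functor.map_sub, toStable_map_eq_zero_of_proj hP,
          E.toStable.map_id, sub_zero]
      inv_hom_id := by rw [← Functor.map_comp, hσz, E.toStable.map_id] }
  refine ⟨B, M, Z, i, v, w, Iso.refl _, Iso.refl _, c, ⟨hc, n, hpo.w, hw⟩, by simp, ?_, ?_⟩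
  · simp only [c, ← Functor.map_comp, hz2, Iso.refl_hom, Category.id_comp]
  · have e : E.toStable.map w = E.toStable.map z ≫ E.toStable.map (-φ) := by
      rw [← Functor.map_comp, ← sub_eq_zero, ← Functor.map_sub]
      have : w - z ≫ (-φ) = r ≫ E.hullπ B := by rw [← hwφ]; simp
      rw [this]
      exact toStable_map_eq_zero_of_proj hP _ _
    exact (congrArg (fun k => E.toStable.map w ≫ k)
      (E.shift.map_id (E.toStable.obj B))).trans ((Category.comp_id _).trans e)

/-- A bicartesian square of the exact category which gives a conflation is homotopy cartesian in the
stable category. -/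
lemma Conf.isHomotopyCartesian {Y Z B X : C} {h : Y ⟶ Z} {j : Y ⟶ B} {t : Z ⟶ X} {f : B ⟶ X}
    (hc : E.Conf (biprod.lift h j) (biprod.desc t (-f))) :
    E.IsHomotopyCartesian (E.toStable.map h) (E.toStable.map j) (E.toStable.map t)
      (E.toStable.map f) := by
  obtain ⟨φ, hφ⟩ := hc.exists_isConnecting
  refine ⟨?_, E.stableBicone Z B, stableBicone_isBilimit Z B, E.toStable.map (-φ), ?_⟩
  · have := E.zero hc
    rw [← Functor.map_comp, ← Functor.map_comp]
    congr 1
    simpa [add_neg_eq_zero] using this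
  · have e1 : E.toStable.map h ≫ (E.stableBicone Z B).inl +
        E.toStable.map j ≫ (E.stableBicone Z B).inr = E.toStable.map (biprod.lift h j) := by
      rw [biprod.lift_eq, Functor.map_add, Functor.map_comp, Functor.map_comp]
      rfl
    have e2 : (E.stableBicone Z B).fst ≫ E.toStable.map t -
        (E.stableBicone Z B).snd ≫ E.toStable.map f = E.toStable.map (biprod.desc t (-f)) := by
      rw [biprod.desc_eq, Preadditive.comp_neg, ← sub_eq_add_neg, Functor.map_sub,
        Functor.map_comp, Functor.map_comp]
      rfl
    rw [e1, e2]
    exact hc.isDistinguished hφ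

/-! ### The induced pair in the stable category -/

/-- Orthogonality can be tested on representatives, so forming perpendicular classes commutes with
passing to the quotient. -/
lemma stableLeftPerp_map_iff (J : MorphismProperty C) {X Y : C} (f : X ⟶ Y) :
    E.stableLeftPerp (E.stableImage J) (E.toStable.map f) ↔ E.leftPerp J f := by
  constructor
  · intro H B₀ B₁ b hb
    exact (stableOrthogonal_iff f b).1 (H _ (stableImage_map hb))
  · rintro H B₀ B₁ _ ⟨b, hb, rfl⟩
    exact (stableOrthogonal_iff f b).2 (H b hb)

lemma stableRightPerp_map_iff (I : MorphismProperty C) {X Y : C} (f : X ⟶ Y) :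
    E.stableRightPerp (E.stableImage I) (E.toStable.map f) ↔ E.rightPerp I f := by
  constructor
  · intro H A₀ A₁ a ha
    exact (stableOrthogonal_iff a f).1 (H _ (stableImage_map ha))
  · rintro H A₀ A₁ _ ⟨a, ha, rfl⟩
    exact (stableOrthogonal_iff a f).2 (H a ha)

variable {I J : MorphismProperty C}

lemma IsIdealCotorsionPair.stable (h : E.IsIdealCotorsionPair I J) :
    E.IsStableIdealCotorsionPair (E.stableImage I) (E.stableImage J) where
  left_ideal := h.left_ideal.stableImage
  right_ideal := h.right_ideal.stableImage
  left_eq := by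
    funext X Y f
    apply propext
    obtain ⟨f, rfl⟩ := toStable_map_surjective (E := E) f
    constructor
    · rintro ⟨g, hg, e⟩
      rw [← e]
      rw [h.left_eq] at hg
      exact (stableLeftPerp_map_iff J g).2 hg
    · intro H
      have := (stableLeftPerp_map_iff J f).1 H
      rw [← h.left_eq] at this
      exact ⟨f, this, rfl⟩
  right_eq := by
    funext X Y f
    apply propext
    obtain ⟨f, rfl⟩ := toStable_map_surjective (E := E) f
    constructor
    · rintro ⟨g, hg, e⟩
      rw [← e]
      rw [h.right_eq] at hg
      exact (stableRightPerp_map_iff I g).2 hg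
    · intro H
      have := (stableRightPerp_map_iff I f).1 H
      rw [← h.right_eq] at this
      exact ⟨f, this, rfl⟩

/-- The image of a morphism of conflations that is the identity on the cokernels is compatible with
the connecting morphisms. -/
lemma IsConnecting.map_comp_shift {B M B' M' A A' : C} {i : B ⟶ M} {p : M ⟶ A} {i' : B' ⟶ M'}
    {p' : M' ⟶ A'} {φ : A ⟶ E.cosyz B} {φ' : A' ⟶ E.cosyz B'} {b : B ⟶ B'} {j : M ⟶ M'}
    {c : A ⟶ A'} (hφ : E.IsConnecting i p φ) (hφ' : E.IsConnecting i' p' φ') (h : E.Conf i p)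
    (h1 : i ≫ j = b ≫ i') (h2 : j ≫ p' = p ≫ c) :
    (E.toStable.map (-φ) : E.toStable.obj A ⟶ E.shift.obj (E.toStable.obj B)) ≫
      E.shift.map (E.toStable.map b) = E.toStable.map c ≫ E.toStable.map (-φ') := by
  have e := (toStable_map_eq_iff _ _).2 (hφ.stableRel h hφ' h1 h2 (E.cosyzMap_isInduced b))
  have e' : E.toStable.map (-φ) ≫ E.toStable.map (E.cosyzMap b) =
      E.toStable.map c ≫ E.toStable.map (-φ') := by
    rw [Functor.map_neg, Functor.map_neg, Preadditive.neg_comp, Preadditive.comp_neg,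
      ← Functor.map_comp, ← Functor.map_comp, e]
  -- By definition, `shift` sends the image of `b` to the image of `cosyzMap b`.
  exact e'

/-- The same diagram serves: its rows become triangles, and its left square is homotopy cartesian
because `conf_left_square` makes it a conflation. -/
lemma IsSpecialPrecover.toStable_map {A X : C} {f : A ⟶ X} (hf : E.IsSpecialPrecover I f) :
    E.IsStableSpecialPrecover (E.stableImage I) (E.toStable.map f) := by
  obtain ⟨hf, K, P, L, k, p, l, g, t, hk, hl, hpo, h2, hg⟩ := hf
  obtain ⟨φ, hφ⟩ := hk.exists_isConnecting
  obtain ⟨ψ, hψ⟩ := hl.exists_isConnecting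
  refine ⟨hf.toStable_map, E.toStable.obj K, E.toStable.obj P, E.toStable.obj L,
    E.toStable.map k, E.toStable.map p, E.toStable.map (-φ), E.toStable.map l,
    E.toStable.map (-ψ), E.toStable.map g, E.toStable.map t, hk.isDistinguished hφ,
    hl.isDistinguished hψ, by rw [← Functor.map_comp, h2], ?_,
    (hk.conf_left_square hl hpo.w h2).isHomotopyCartesian, (stableRightPerp_map_iff I g).2 hg⟩
  refine (hφ.map_comp_shift hψ hk hpo.w (by simpa using h2 : _ = p ≫ 𝟙 _)).trans ?_
  rw [E.toStable.map_id, Category.id_comp]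

lemma IsSpecialPreenvelope.toStable_map {A X : C} {f : X ⟶ A} (hf : E.IsSpecialPreenvelope J f) :
    E.IsStableSpecialPreenvelope (E.stableImage J) (E.toStable.map f) := by
  obtain ⟨hf, L, P, K, l, i, k, g, t, hl, hk, hpb, h1, hg⟩ := hf
  obtain ⟨φ, hφ⟩ := hk.exists_isConnecting
  obtain ⟨ψ, hψ⟩ := hl.exists_isConnecting
  refine ⟨hf.toStable_map, E.toStable.obj L, E.toStable.obj P, E.toStable.obj K,
    E.toStable.map l, E.toStable.map (-ψ), E.toStable.map i, E.toStable.map k,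
    E.toStable.map (-φ), E.toStable.map g, E.toStable.map t, hl.isDistinguished hψ,
    hk.isDistinguished hφ, by rw [← Functor.map_comp, h1], ?_,
    (hl.conf_right_square hk h1 hpb.w.symm).isHomotopyCartesian, (stableLeftPerp_map_iff J g).2 hg⟩
  refine (hψ.map_comp_shift hφ hl (by simpa using h1 : _ = 𝟙 _ ≫ i) hpb.w).symm.trans ?_
  rw [E.toStable.map_id, E.shift.map_id]
  exact Category.comp_id _

lemma IsCompleteIdealCotorsionPair.stable (h : E.IsCompleteIdealCotorsionPair I J) :
    E.IsStableCompleteIdealCotorsionPair (E.stableImage I) (E.stableImage J) where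
  isIdealCotorsionPair := h.isIdealCotorsionPair.stable
  exists_precover := by
    rintro ⟨X⟩
    obtain ⟨A, f, hf⟩ := h.exists_precover X
    exact ⟨_, _, hf.toStable_map⟩
  exists_preenvelope := by
    rintro ⟨X⟩
    obtain ⟨A, f, hf⟩ := h.exists_preenvelope X
    exact ⟨_, _, hf.toStable_map⟩

/-- A precover in the stable category gives, after adding a projective object, a precover in the
exact category. -/
lemma IsIdealCotorsionPair.precovering_of_stable (h : E.IsIdealCotorsionPair I J)
    (hI : IsPrecovering (E.stableImage I)) : IsPrecovering I := by
  intro X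
  obtain ⟨A, _, ⟨f, hf, rfl⟩, hf'⟩ := hI (E.toStable.obj X)
  obtain ⟨P, p, hP, hp⟩ := hE.enough_proj X
  refine ⟨A.as ⊞ P, biprod.desc f p, h.left_ideal.desc_mem hf
    (by simpa using h.left_of_proj hP (𝟙 P) p), ?_⟩
  intro W a ha
  obtain ⟨s, hs⟩ := hf' (E.toStable.map a) (stableImage_map ha)
  obtain ⟨s, rfl⟩ := toStable_map_surjective (E := E) (Y := A.as) s
  have hs' : E.toStable.map a = E.toStable.map (s ≫ f) := by
    rw [Functor.map_comp]; exact hs.symm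
  -- The error `a - s ≫ f` factors through a projective `Q`, and `y : Q ⟶ X` lifts along `p`, so the
  -- summand `P` absorbs it.
  obtain ⟨Q, x, y, hQ, e⟩ := (toStable_map_eq_iff _ _).1 hs'
  obtain ⟨y', hy'⟩ := hQ.exists_lift hp y
  refine ⟨biprod.lift s (x ≫ y'), ?_⟩
  rw [biprod.lift_desc, Category.assoc, hy', ← e, add_sub_cancel]

end Stable

end ExactStructure

/-! ### The four equivalent conditions -/

theorem corollary1p2 {C : Type u} [Category.{v} C] [Preadditive C] [HasZeroObject C] [HasBinaryBiproducts C]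
    (E : ExactStructure C) [E.IsFrobenius] (I J : MorphismProperty C)
    (hIJ : E.IsIdealCotorsionPair I J) :
    List.TFAE
      [IsPrecovering I,
       IsPreenveloping J,
       E.IsCompleteIdealCotorsionPair I J,
       E.IsStableCompleteIdealCotorsionPair (E.stableImage I) (E.stableImage J)] := by
  tfae_have 1 → 3 := hIJ.complete_of_precovering
  tfae_have 3 → 2 := fun h X =>
    let ⟨A, f, hf⟩ := h.exists_preenvelope X
    ⟨A, f, hf.1⟩
  tfae_have 2 → 1 := hIJ.precovering_of_preenveloping
  tfae_have 3 → 4 := fun h => h.stable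
  -- Only the existence of stable precovers is used; their specialness is not lifted but rebuilt in
  -- the exact category by `1 → 3`.
  tfae_have 4 → 1 := fun h => hIJ.precovering_of_stable fun X =>
    let ⟨A, f, hf⟩ := h.exists_precover X
    ⟨A, f, hf.1⟩
  tfae_finish
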